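/- Let $d\ge 1$. For $\varepsilon\in\mathbf R$ let $\mu_\varepsilon$ denote the law on $\mathbf R^{\mathbf Z^d}$ of the centered stationary (translation-invariant) Gaussian field $(X_i)_{i\in\mathbf Z^d}$ such that, for every $i\in\mathbf Z^d$, $$\mu_\varepsilon\big(X_i\in\cdot \mid X_j=\xi_j\ \forall j\ne i\big)=\mathcal N\Big(\frac{\varepsilon}{2d}\sum_{j:\,\|j-i\|_1=1}\xi_j,\ 1\Big)\quad\text{for }\mu_\varepsilon\text{-a.e. }\xi .$$ There is $\varepsilon_0>0$ (depending on $d$) such that for every $\varepsilon$ with $|\varepsilon|<\varepsilon_0$ this law $\mu_\varepsilon$ exists and is unique, and the following hold. 1. $\mu_\varepsilon$ is a factor of an i.i.d. process: there are a probability space $(\mathcal Y,\mathcal F,\nu)$ and a measurable map $F:\mathcal Y^{\mathbf Z^d}\to\mathbf R^{\mathbf Z^d}$ commuting with all translations of $\mathbf Z^d$ such that $\mu_\varepsilon$ is the image of $\nu^{\otimes\mathbf Z^d}$ under $F$. 2. There is $c>0$ such that for every integer $l\ge 0$ there is an $l$-dependent probability measure $\nu_l$ on $\mathbf R^{\mathbf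 Z^d}$ with $$d_{\mathrm{TV}}(\mu_\varepsilon|_\Lambda,\nu_l|_\Lambda)\le|\Lambda|\,e^{-cl}\quad\text{for every finite }\Lambda\subset\mathbf Z^d .$$ Here a measure is $l$-dependent if, for a field $X$ with that law, $X|_A$ and $X|_B$ are independent for all $A,B\subset\mathbf Z^d$ with $\|a-b\|_1>l$ for all $a\in A$, $b\in B$; $\mu|_\Lambda$ is the law of $X|_\Lambda$ when $X$ has law $\mu$; and $d_{\mathrm{TV}}(\mu,\nu)=\sup_A|\mu(A)-\nu(A)|$ over measurable sets $A$. -/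

import Mathlib

open MeasureTheory ProbabilityTheory

namespace GaussFactor

/-- The sites of the lattice `ℤ^d`. -/
abbrev Site (d : ℕ) : Type := Fin d → ℤ

/-- The `ℓ¹` distance on `ℤ^d`. -/
def l1Dist {d : ℕ} (i j : Site d) : ℕ := ∑ k, (i k - j k).natAbs

/-- Translation of configurations by the vector `v`. -/
def shift {d : ℕ} {S : Type*} (v : Site d) (x : Site d → S) : Site d → S :=
  fun i => x (i + v)

/-- The average of the configuration `x` over the `2d` nearest neighbours of the site `i`. -/
noncomputable def neighbourAverage {d : ℕ} (x : Site d → ℝ) (i : Site d) : ℝ :=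
  (∑ k : Fin d, (x (i + Pi.single k 1) + x (i - Pi.single k 1))) / (2 * d)

/-- Translation invariance of a measure on `S^(ℤ^d)`. -/
def IsStationary {d : ℕ} {S : Type*} [MeasurableSpace S] (μ : Measure (Site d → S)) : Prop :=
  ∀ v : Site d, μ.map (shift v) = μ

/-- `μ` is the law of a centered stationary Gaussian field on `ℤ^d` such that for every site `i`
the conditional law of `X_i` given `(X_j)_{j ≠ i}` is the normal law of variance `1` whose mean is
`ε` times the average of the nearest neighbours of `i`. -/
structure IsGaussianMarkovField (d : ℕ) (ε : ℝ) (μ : Measure (Site d → ℝ)) : Prop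
    extends IsProbabilityMeasure μ where
  gaussian : IsGaussianProcess (fun (i : Site d) (x : Site d → ℝ) => x i) μ
  centered : ∀ i : Site d, ∫ x, x i ∂μ = 0
  stationary : IsStationary μ
  conditional : ∀ i : Site d, ∀ᵐ ξ ∂μ,
    condDistrib (fun x : Site d → ℝ => x i)
        (fun (x : Site d → ℝ) (j : {j : Site d // j ≠ i}) => x j) μ (fun j => ξ j)
      = gaussianReal (ε * neighbourAverage ξ i) 1

/-- `μ` is a factor of an i.i.d. process: the image of a product measure `ν^{⊗ ℤ^d}` under a
measurable map that commutes with all translations. -/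
def IsFactorOfIID {d : ℕ} {S : Type*} [MeasurableSpace S] (μ : Measure (Site d → S)) : Prop :=
  ∃ (Y : Type) (_ : MeasurableSpace Y) (ν : Measure Y) (_ : IsProbabilityMeasure ν)
    (F : (Site d → Y) → (Site d → S)),
    Measurable F ∧
    (∀ (v : Site d) (y : Site d → Y), F (shift v y) = shift v (F y)) ∧
    (Measure.infinitePi (fun _ : Site d => ν)).map F = μ

/-- `μ` is `l`-dependent: the restrictions of the field to any two sets of sites at `ℓ¹` distance
greater than `l` are independent. -/
def IsDependent {d : ℕ} {S : Type*} [MeasurableSpace S] (l : ℕ)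
    (μ : Measure (Site d → S)) : Prop :=
  ∀ A B : Set (Site d), (∀ a ∈ A, ∀ b ∈ B, l < l1Dist a b) →
    IndepFun (fun (x : Site d → S) (a : A) => x a) (fun (x : Site d → S) (b : B) => x b) μ

/-- Total variation distance between two probability measures:
the supremum of `|μ A - ν A|` over measurable sets `A`. -/
noncomputable def tvDist {α : Type*} [MeasurableSpace α] (μ ν : Measure α) : ℝ :=
  ⨆ A : {A : Set α // MeasurableSet A}, |μ.real A - ν.real A|

end GaussFactor

/-! Let P be the averaging operator of the simple random walk (`walk`). The conditional laws say
that, for each i, X_i - ε(PX)_i is standard normal and independent of all the other coordinates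
(`conditional_iff`). Pairing this residual with X_j shows that the covariance K(·, j) solves K = δ_j
+ εPK. Stationarity bounds K, and εP contracts the sup norm, so K is the Green function G = Σ ε^n
P^n (`covariance_eq_green`). A centered Gaussian law is determined by its covariance, which gives
uniqueness. Conversely, covariance G forces the prescribed conditional laws
(`conditional_of_covariance_eq_green`).

Existence and both conclusions come from one explicit construction, `limitField`. Let a_n be the
coefficients of ((1+x)/(2(1-x)))^(1/2), so that 1/(1-x) = 1/2 + (Σ a_n x^n)^2
(`exists_sqrt_coefficients`). Since P is symmetric, X = η/√2 + Σ a_n ε^n P^n ξ, with η and ξ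
independent white noises, has covariance G. This is an equivariant measurable function of i.i.d.
noise, hence a factor.

For the approximation, keep only the terms n ≤ l/2. As P^n has range n, the truncated Gaussian field
has zero covariance beyond distance l and is l-dependent (`isDependent_map_truncField`). The spare
noise η turns closeness in L¹ into closeness in total variation: given ξ, both fields on Λ are
products of normals of variance 1/2 whose means differ by the tail of the series, and such normals
are as close as their means. Averaging over ξ bounds the distance by |Λ| times the L¹ norm of the
tail, which is geometrically small (`tvBound_map_noisy`). -/

namespace GaussFactor

open Filter Topology Complex
open scoped NNReal

/-! ### Centered Gaussian processes: limits, and determination by the covariance. -/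

section GaussianProcess

variable {T Ω : Type*} {mΩ : MeasurableSpace Ω} {P : Measure Ω}

/-- The second moment of a finite linear combination of square integrable variables. -/
theorem integral_linearCombination_sq {X : T → Ω → ℝ} (hX : ∀ t, MemLp (X t) 2 P)
    (I : Finset T) (c : T → ℝ) :
    ∫ ω, (∑ t ∈ I, c t * X t ω) ^ 2 ∂P =
      ∑ s ∈ I, ∑ t ∈ I, c s * c t * ∫ ω, X s ω * X t ω ∂P := by
  have : ∀ ω, (∑ t ∈ I, c t * X t ω) ^ 2
      = ∑ s ∈ I, ∑ t ∈ I, c s * c t * (X s ω * X t ω) := by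
    intro ω
    rw [sq, Finset.sum_mul_sum]
    exact Finset.sum_congr rfl fun s _ => Finset.sum_congr rfl fun t _ => by ring
  simp_rw [this]
  have hI : ∀ s t, Integrable (fun ω => c s * c t * (X s ω * X t ω)) P := fun s t =>
    ((hX s).integrable_mul (hX t)).const_mul _
  rw [integral_finsetSum _ fun s _ => integrable_finsetSum _ fun t _ => hI s t]
  refine Finset.sum_congr rfl fun s _ => ?_
  rw [integral_finsetSum _ fun t _ => hI s t]
  simp_rw [integral_const_mul]

/-- A finite linear combination of a centered Gaussian process is a centered Gaussian variable whose
variance is the corresponding quadratic form in the covariances. -/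
theorem map_linearCombination_eq_gaussianReal {X : T → Ω → ℝ} (hX : IsGaussianProcess X P)
    (h0 : ∀ t, ∫ ω, X t ω ∂P = 0) (I : Finset T) (c : T → ℝ) :
    P.map (fun ω => ∑ t ∈ I, c t * X t ω) =
      gaussianReal 0 (∑ s ∈ I, ∑ t ∈ I, c s * c t * ∫ ω, X s ω * X t ω ∂P).toNNReal := by
  have hprob := hX.isProbabilityMeasure
  have hL2 : ∀ t, MemLp (X t) 2 P := fun t => (hX.hasGaussianLaw_eval t).memLp_two
  have hint : ∀ t, Integrable (X t) P := fun t => (hX.hasGaussianLaw_eval t).integrable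
  have hg : HasGaussianLaw (fun ω => ∑ t ∈ I, c t * X t ω) P :=
    (hX.smul c).hasGaussianLaw_fun_sum
  have hmean : ∫ ω, ∑ t ∈ I, c t * X t ω ∂P = 0 := by
    rw [integral_finsetSum _ fun t _ => (hint t).const_mul _]
    simp [integral_const_mul, h0]
  rw [hg.map_eq_gaussianReal, hmean, variance_of_integral_eq_zero hg.aemeasurable hmean]
  congr 2
  exact integral_linearCombination_sq hL2 I c

/-- An almost sure limit of centered Gaussian variables with convergent variances is Gaussian. -/
theorem map_eq_gaussianReal_of_tendsto [IsProbabilityMeasure P] {U : ℕ → Ω → ℝ} {V : Ω → ℝ}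
    {v : ℕ → ℝ≥0} {w : ℝ≥0} (hUm : ∀ n, AEMeasurable (U n) P) (hVm : AEMeasurable V P)
    (hU : ∀ n, P.map (U n) = gaussianReal 0 (v n))
    (hlim : ∀ᵐ ω ∂P, Tendsto (fun n => U n ω) atTop (𝓝 (V ω)))
    (hv : Tendsto v atTop (𝓝 w)) : P.map V = gaussianReal 0 w := by
  have := Measure.isProbabilityMeasure_map (μ := P) hVm
  refine Measure.ext_of_charFun (funext fun t => ?_)
  have hchar : ∀ W : Ω → ℝ, AEMeasurable W P →
      charFun (P.map W) t = ∫ ω, cexp (t * W ω * I) ∂P := by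
    intro W hW
    rw [charFun_apply_real, integral_map hW (by fun_prop)]
  have h1 : Tendsto (fun n => ∫ ω, cexp (t * U n ω * I) ∂P) atTop
      (𝓝 (∫ ω, cexp (t * V ω * I) ∂P)) := by
    refine tendsto_integral_of_dominated_convergence (fun _ => 1) (fun n => ?_)
      (integrable_const _) (fun n => ?_) ?_
    · have := hUm n
      exact AEMeasurable.aestronglyMeasurable (by fun_prop)
    · refine ae_of_all _ fun ω => ?_
      rw [← ofReal_mul, norm_exp_ofReal_mul_I]
    · filter_upwards [hlim] with ω hω
      have : Continuous fun x : ℝ => cexp (t * x * I) := by fun_prop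
      exact (this.tendsto _).comp hω
  have h2 : Tendsto (fun n => ∫ ω, cexp (t * U n ω * I) ∂P) atTop
      (𝓝 (charFun (gaussianReal 0 w) t)) := by
    simp_rw [← hchar _ (hUm _), hU, charFun_gaussianReal]
    have : Continuous fun x : ℝ≥0 => cexp (t * (0 : ℝ) * I - x * t ^ 2 / 2) := by fun_prop
    exact (this.tendsto w).comp hv
  rw [hchar _ hVm]
  exact tendsto_nhds_unique h1 h2

/-- Linear functionals on a finite power of the reals are linear combinations of coordinates. -/
theorem dual_restrict_apply {I : Finset T} (L : (I → ℝ) →L[ℝ] ℝ) :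
    ∃ c : T → ℝ, ∀ x : T → ℝ, L (I.restrict x) = ∑ t ∈ I, c t * x t := by
  classical
  refine ⟨fun t => if h : t ∈ I then L (Pi.single ⟨t, h⟩ 1) else 0, fun x => ?_⟩
  have : I.restrict x = ∑ t : I, x t • (Pi.single t (1 : ℝ) : I → ℝ) := by
    ext s
    simp [Finset.sum_apply, Pi.single_apply]
  rw [this, map_sum, ← Finset.sum_coe_sort I]
  refine Finset.sum_congr rfl fun t _ => ?_
  simp [mul_comm]

/-- A pointwise almost sure limit of centered Gaussian processes with convergent covariances is a
centered Gaussian process with the limiting covariance. -/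
theorem isGaussianProcess_of_tendsto [IsProbabilityMeasure P] {X : ℕ → T → Ω → ℝ} {Y : T → Ω → ℝ}
    {K : T → T → ℝ} (hX : ∀ n, IsGaussianProcess (X n) P) (h0 : ∀ n t, ∫ ω, X n t ω ∂P = 0)
    (hY : ∀ t, Measurable (Y t))
    (hlim : ∀ t, ∀ᵐ ω ∂P, Tendsto (fun n => X n t ω) atTop (𝓝 (Y t ω)))
    (hK : ∀ s t, Tendsto (fun n => ∫ ω, X n s ω * X n t ω ∂P) atTop (𝓝 (K s t))) :
    IsGaussianProcess Y P ∧ (∀ t, ∫ ω, Y t ω ∂P = 0) ∧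
      ∀ s t, ∫ ω, Y s ω * Y t ω ∂P = K s t := by
  -- Cramér–Wold reduction: everything below is read off from the laws of finite linear
  -- combinations.
  have key : ∀ (I : Finset T) (c : T → ℝ), P.map (fun ω => ∑ t ∈ I, c t * Y t ω) =
      gaussianReal 0 (∑ s ∈ I, ∑ t ∈ I, c s * c t * K s t).toNNReal := by
    intro I c
    refine map_eq_gaussianReal_of_tendsto (U := fun n ω => ∑ t ∈ I, c t * X n t ω)
      (fun n => ?_) ?_ (fun n => map_linearCombination_eq_gaussianReal (hX n) (h0 n) I c) ?_ ?_
    · exact Finset.aemeasurable_fun_sum _ fun t _ => ((hX n).aemeasurable t).const_mul _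
    · exact Finset.aemeasurable_fun_sum _ fun t _ => (hY t).aemeasurable.const_mul _
    · have : ∀ᵐ ω ∂P, ∀ t ∈ I, Tendsto (fun n => X n t ω) atTop (𝓝 (Y t ω)) :=
        (ae_ball_iff I.countable_toSet).2 fun t _ => hlim t
      filter_upwards [this] with ω hω
      exact tendsto_finsetSum _ fun t ht => (hω t ht).const_mul _
    · exact (continuous_real_toNNReal.tendsto _).comp (tendsto_finsetSum _ fun s _ =>
        tendsto_finsetSum _ fun t _ => (hK s t).const_mul _)
  have hG : IsGaussianProcess Y P := by
    refine ⟨fun I => ⟨isGaussian_of_map_eq_gaussianReal fun L => ?_⟩⟩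
    obtain ⟨c, hc⟩ := dual_restrict_apply L
    refine ⟨0, (∑ s ∈ I, ∑ t ∈ I, c s * c t * K s t).toNNReal, ?_⟩
    rw [Measure.map_map (by fun_prop) (by fun_prop), ← key I c]
    congr 1
    ext ω
    exact hc fun t => Y t ω
  have hmean : ∀ t, ∫ ω, Y t ω ∂P = 0 := by
    intro t
    have h := key {t} 1
    simp only [Finset.sum_singleton, Pi.one_apply, one_mul] at h
    have h' := integral_map (μ := P) (hY t).aemeasurable (f := fun x => x) (by fun_prop)
    rw [← h', h, integral_id_gaussianReal]
  have hsymm : ∀ s t, K s t = K t s := fun s t => tendsto_nhds_unique (hK s t) (by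
    simpa only [mul_comm] using hK t s)
  have hvar : ∀ (I : Finset T) (c : T → ℝ), ∫ ω, (∑ t ∈ I, c t * Y t ω) ^ 2 ∂P =
      ∑ s ∈ I, ∑ t ∈ I, c s * c t * K s t := by
    intro I c
    -- The limiting quadratic form is a limit of second moments, so `toNNReal` loses nothing.
    have hnn : 0 ≤ ∑ s ∈ I, ∑ t ∈ I, c s * c t * K s t := by
      refine ge_of_tendsto (tendsto_finsetSum _ fun s _ =>
        tendsto_finsetSum _ fun t _ => (hK s t).const_mul (c s * c t)) (Eventually.of_forall ?_)
      intro n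
      have hL2 : ∀ t, MemLp (X n t) 2 P := fun t => ((hX n).hasGaussianLaw_eval t).memLp_two
      rw [← integral_linearCombination_sq hL2]
      exact integral_nonneg fun ω => sq_nonneg _
    have hm : Measurable fun ω => ∑ t ∈ I, c t * Y t ω :=
      Finset.measurable_fun_sum _ fun t _ => (hY t).const_mul _
    have h1 := integral_map (μ := P) hm.aemeasurable (f := fun x => x ^ 2) (by fun_prop)
    rw [← h1, key, ← variance_of_integral_eq_zero (X := fun x => x) (by fun_prop)
      (by simp [integral_id_gaussianReal]), variance_fun_id_gaussianReal, Real.coe_toNNReal _ hnn]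
  have hL2 : ∀ t, MemLp (Y t) 2 P := fun t => (hG.hasGaussianLaw_eval t).memLp_two
  refine ⟨hG, hmean, fun s t => ?_⟩
  classical
  -- Polarization: the forms on {s}, {t} and {s, t} with unit coefficients determine the (s, t)
  -- entry.
  have hsq : ∀ I : Finset T, ∑ s ∈ I, ∑ t ∈ I, ∫ ω, Y s ω * Y t ω ∂P
      = ∑ s ∈ I, ∑ t ∈ I, K s t := fun I => by
    simpa using (integral_linearCombination_sq hL2 I 1).symm.trans (hvar I 1)
  by_cases hst : s = t
  · subst hst
    simpa using hsq {s}
  · have h1 := hsq {s}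
    have h2 := hsq {t}
    have h3 := hsq {s, t}
    simp only [Finset.sum_singleton, Finset.sum_pair hst] at h1 h2 h3
    have h4 : ∫ ω, Y t ω * Y s ω ∂P = ∫ ω, Y s ω * Y t ω ∂P := by simp_rw [mul_comm]
    have := hsymm s t
    linarith

/-- The law of a centered Gaussian process is determined by its covariances. -/
theorem eq_of_forall_integral_mul_eq {μ μ' : Measure (T → ℝ)}
    (hμ : IsGaussianProcess (fun (t : T) (x : T → ℝ) => x t) μ)
    (hμ' : IsGaussianProcess (fun (t : T) (x : T → ℝ) => x t) μ')
    (h0 : ∀ t, ∫ x, x t ∂μ = 0) (h0' : ∀ t, ∫ x, x t ∂μ' = 0)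
    (h : ∀ s t, ∫ x, x s * x t ∂μ = ∫ x, x s * x t ∂μ') : μ = μ' := by
  have := hμ.isProbabilityMeasure
  have := hμ'.isProbabilityMeasure
  have hproj : IsProjectiveLimit μ' fun I : Finset T => μ.map I.restrict := by
    intro I
    have hm : Measurable (I.restrict (π := fun _ => ℝ)) := I.measurable_restrict
    have := Measure.isProbabilityMeasure_map (μ := μ) hm.aemeasurable
    have := Measure.isProbabilityMeasure_map (μ := μ') hm.aemeasurable
    refine Measure.ext_of_charFunDual (funext fun L => ?_)
    obtain ⟨c, hc⟩ := dual_restrict_apply L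
    have e : ∀ ρ : Measure (T → ℝ), (ρ.map I.restrict).map L
        = ρ.map fun x => ∑ t ∈ I, c t * x t := by
      intro ρ
      rw [Measure.map_map (by fun_prop) (by fun_prop)]
      congr 1
      ext x
      exact hc x
    rw [charFunDual_eq_charFun_map_one, charFunDual_eq_charFun_map_one, e, e,
      map_linearCombination_eq_gaussianReal hμ h0 I c,
      map_linearCombination_eq_gaussianReal hμ' h0' I c]
    simp_rw [h]
  exact IsProjectiveLimit.unique (P := fun I : Finset T => μ.map I.restrict) (fun I => rfl) hproj

end GaussianProcess

end GaussFactor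

namespace GaussFactor

open Filter Topology

/-! ### The random walk operator, its kernel and its Green function. -/

section Lattice

variable {d : ℕ}

theorem neighbourAverage_add (x y : Site d → ℝ) :
    neighbourAverage (x + y) = neighbourAverage x + neighbourAverage y := by
  ext i
  simp only [neighbourAverage, Pi.add_apply, ← add_div, ← Finset.sum_add_distrib]
  congr 1
  exact Finset.sum_congr rfl fun k _ => by ring

theorem neighbourAverage_smul (c : ℝ) (x : Site d → ℝ) :
    neighbourAverage (c • x) = c • neighbourAverage x := by
  ext i
  simp only [neighbourAverage, Pi.smul_apply, smul_eq_mul, ← mul_add, ← Finset.mul_sum]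
  ring

/-- The transition operator of the simple random walk on the lattice. -/
noncomputable def walk (d : ℕ) : Module.End ℝ (Site d → ℝ) where
  toFun := neighbourAverage
  map_add' := neighbourAverage_add
  map_smul' := neighbourAverage_smul

theorem walk_apply (x : Site d → ℝ) : walk d x = neighbourAverage x := rfl

theorem walk_pow_succ_apply (n : ℕ) (x : Site d → ℝ) :
    (walk d ^ (n + 1)) x = neighbourAverage ((walk d ^ n) x) := by
  rw [pow_succ', Module.End.mul_apply, walk_apply]

theorem abs_neighbourAverage_le (hd : 1 ≤ d) {x : Site d → ℝ} {C : ℝ} (hx : ∀ i, |x i| ≤ C)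
    (i : Site d) : |neighbourAverage x i| ≤ C := by
  have hd' : (0 : ℝ) < 2 * d := by positivity
  rw [neighbourAverage, abs_div, abs_of_pos hd', div_le_iff₀ hd']
  refine (Finset.abs_sum_le_sum_abs _ _).trans ?_
  refine (Finset.sum_le_card_nsmul _ _ (2 * C) fun k _ => ?_).trans (le_of_eq ?_)
  · refine (abs_add_le _ _).trans ?_
    linarith [hx (i + Pi.single k 1), hx (i - Pi.single k 1)]
  · simp
    ring

theorem neighbourAverage_mono {x y : Site d → ℝ} (hxy : ∀ i, x i ≤ y i) (i : Site d) :
    neighbourAverage x i ≤ neighbourAverage y i := by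
  unfold neighbourAverage
  gcongr <;> exact hxy _

theorem abs_neighbourAverage_le_neighbourAverage_abs (x : Site d → ℝ) (i : Site d) :
    |neighbourAverage x i| ≤ neighbourAverage (fun j => |x j|) i := by
  unfold neighbourAverage
  rw [abs_div, abs_of_nonneg (by positivity : (0 : ℝ) ≤ 2 * d)]
  gcongr
  refine (Finset.abs_sum_le_sum_abs _ _).trans ?_
  exact Finset.sum_le_sum fun k _ => abs_add_le _ _

theorem abs_walk_pow_le (hd : 1 ≤ d) {x : Site d → ℝ} {C : ℝ} (hx : ∀ i, |x i| ≤ C) (n : ℕ)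
    (i : Site d) : |(walk d ^ n) x i| ≤ C := by
  induction n generalizing i with
  | zero => simpa using hx i
  | succ n ih =>
    rw [walk_pow_succ_apply]
    exact abs_neighbourAverage_le hd ih i

theorem abs_walk_pow_le_walk_pow_abs (x : Site d → ℝ) (n : ℕ) (i : Site d) :
    |(walk d ^ n) x i| ≤ (walk d ^ n) (fun j => |x j|) i := by
  induction n generalizing i with
  | zero => simp
  | succ n ih =>
    rw [walk_pow_succ_apply, walk_pow_succ_apply]
    exact (abs_neighbourAverage_le_neighbourAverage_abs _ i).trans (neighbourAverage_mono ih i)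

theorem neighbourAverage_shift (v : Site d) (x : Site d → ℝ) :
    neighbourAverage (shift v x) = shift v (neighbourAverage x) := by
  ext i
  simp only [neighbourAverage, shift]
  congr 1
  refine Finset.sum_congr rfl fun k _ => ?_
  rw [add_right_comm, add_sub_right_comm]

theorem walk_pow_shift (v : Site d) (x : Site d → ℝ) (n : ℕ) :
    (walk d ^ n) (shift v x) = shift v ((walk d ^ n) x) := by
  induction n with
  | zero => simp
  | succ n ih => rw [walk_pow_succ_apply, walk_pow_succ_apply, ih, neighbourAverage_shift]

/-- The `n`-step transition probability of the simple random walk from `i` to `j`. -/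
noncomputable def walkKernel (n : ℕ) (i j : Site d) : ℝ := (walk d ^ n) (Pi.single j 1) i

theorem walkKernel_zero (i j : Site d) : walkKernel 0 i j = if i = j then 1 else 0 := by
  simp [walkKernel, Pi.single_apply]

theorem walkKernel_succ (n : ℕ) (i j : Site d) :
    walkKernel (n + 1) i j = neighbourAverage (fun k => walkKernel n k j) i := by
  rw [walkKernel, walk_pow_succ_apply]
  rfl

theorem abs_walkKernel_le (hd : 1 ≤ d) (n : ℕ) (i j : Site d) : |walkKernel n i j| ≤ 1 := by
  refine abs_walk_pow_le hd (fun k => ?_) n i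
  by_cases h : k = j <;> simp [h]

/-- The walk operator sends the point mass at i to the average of the point masses at the neighbours
of i. Hence both sides are averages over these neighbours of n-step kernels, to which induction
applies. -/
theorem walkKernel_symm (n : ℕ) (i j : Site d) : walkKernel n i j = walkKernel n j i := by
  induction n generalizing i j with
  | zero => simp [walkKernel_zero, eq_comm]
  | succ n ih =>
    have h : walk d (Pi.single i 1) = ((2 * d : ℝ)⁻¹) • ∑ k : Fin d,
        ((Pi.single (i + Pi.single k 1) 1 : Site d → ℝ) + Pi.single (i - Pi.single k 1) 1) := by
      ext m
      simp only [walk_apply, neighbourAverage, Pi.smul_apply, Finset.sum_apply, Pi.add_apply,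
        smul_eq_mul, div_eq_inv_mul, Pi.single_apply]
      congr 1
      refine Finset.sum_congr rfl fun k _ => ?_
      rw [add_comm]
      congr 2
      · rw [sub_eq_iff_eq_add]
      · rw [eq_sub_iff_add_eq]
    rw [walkKernel_succ]
    conv_rhs => rw [walkKernel, pow_succ, Module.End.mul_apply, h]
    simp only [map_smul, map_sum, map_add, Pi.smul_apply, Finset.sum_apply, Pi.add_apply,
      smul_eq_mul, neighbourAverage, div_eq_inv_mul]
    congr 1
    refine Finset.sum_congr rfl fun k _ => ?_
    rw [ih, ih (i - _)]
    rfl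

theorem l1Dist_self (i : Site d) : l1Dist i i = 0 := by simp [l1Dist]

theorem l1Dist_triangle (i j k : Site d) : l1Dist i k ≤ l1Dist i j + l1Dist j k := by
  unfold l1Dist
  rw [← Finset.sum_add_distrib]
  exact Finset.sum_le_sum fun m _ => by omega

theorem l1Dist_add_single (i : Site d) (k : Fin d) : l1Dist i (i + Pi.single k 1) = 1 := by
  simp [l1Dist, Pi.single_apply, apply_ite]

theorem l1Dist_sub_single (i : Site d) (k : Fin d) : l1Dist i (i - Pi.single k 1) = 1 := by
  simp [l1Dist, Pi.single_apply, apply_ite]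

/-- Finite speed of the walk; this is the source of the l-dependence of the truncated field. -/
theorem walkKernel_eq_zero {n : ℕ} {i j : Site d} (h : n < l1Dist i j) :
    walkKernel n i j = 0 := by
  induction n generalizing i with
  | zero =>
    rw [walkKernel_zero, if_neg]
    rintro rfl
    simp [l1Dist_self] at h
  | succ n ih =>
    rw [walkKernel_succ, neighbourAverage]
    simp only [div_eq_zero_iff]
    left
    refine Finset.sum_eq_zero fun k _ => ?_
    have h1 := l1Dist_triangle i (i + Pi.single k 1) j
    have h2 := l1Dist_triangle i (i - Pi.single k 1) j
    rw [l1Dist_add_single] at h1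
    rw [l1Dist_sub_single] at h2
    rw [ih (by omega), ih (by omega), add_zero]

/-- The Green function of the random walk with killing parameter `ε`. -/
noncomputable def green (ε : ℝ) (i j : Site d) : ℝ := ∑' n, ε ^ n * walkKernel n i j

theorem norm_green_term_le (hd : 1 ≤ d) (ε : ℝ) (i j : Site d) (n : ℕ) :
    ‖ε ^ n * walkKernel n i j‖ ≤ |ε| ^ n := by
  rw [norm_mul, norm_pow, Real.norm_eq_abs, Real.norm_eq_abs]
  exact mul_le_of_le_one_right (by positivity) (abs_walkKernel_le hd n i j)

theorem summable_green (hd : 1 ≤ d) {ε : ℝ} (hε : |ε| < 1) (i j : Site d) :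
    Summable fun n => ε ^ n * walkKernel n i j :=
  .of_norm_bounded (summable_geometric_of_lt_one (abs_nonneg _) hε) (norm_green_term_le hd ε i j)

theorem abs_green_le (hd : 1 ≤ d) {ε : ℝ} (hε : |ε| < 1) (i j : Site d) :
    |green ε i j| ≤ (1 - |ε|)⁻¹ :=
  tsum_of_norm_bounded (hasSum_geometric_of_lt_one (abs_nonneg _) hε) (norm_green_term_le hd ε i j)

theorem green_eq (hd : 1 ≤ d) {ε : ℝ} (hε : |ε| < 1) (i j : Site d) :
    green ε i j = (if i = j then 1 else 0) + ε * neighbourAverage (fun k => green ε k j) i := by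
  have h1 : HasSum (fun n => ε ^ (n + 1) * walkKernel (n + 1) i j)
      (ε * neighbourAverage (fun k => green ε k j) i) := by
    have h : HasSum (fun n => ε * ((∑ k : Fin d,
        (ε ^ n * walkKernel n (i + Pi.single k 1) j + ε ^ n * walkKernel n (i - Pi.single k 1) j))
          / (2 * d))) (ε * neighbourAverage (fun k => green ε k j) i) :=
      ((hasSum_sum fun k _ => (summable_green hd hε _ j).hasSum.add
        (summable_green hd hε _ j).hasSum).div_const _).mul_left _
    convert h using 2 with n
    rw [walkKernel_succ, neighbourAverage]
    simp_rw [← mul_add, ← Finset.mul_sum]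
    ring
  rw [green, (summable_green hd hε i j).tsum_eq_zero_add, h1.tsum_eq, walkKernel_zero, pow_zero,
    one_mul]

/-- The resolvent equation has at most one bounded solution. -/
theorem eq_of_resolvent_eq (hd : 1 ≤ d) {ε : ℝ} (hε : |ε| < 1) {f g b : Site d → ℝ} {C : ℝ}
    (hf : ∀ i, |f i| ≤ C) (hg : ∀ i, |g i| ≤ C)
    (hfe : ∀ i, f i = b i + ε * neighbourAverage f i)
    (hge : ∀ i, g i = b i + ε * neighbourAverage g i) : f = g := by
  have h : ∀ i, (f - g) i = ε * neighbourAverage (f - g) i := by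
    intro i
    have : neighbourAverage (f - g) = neighbourAverage f - neighbourAverage g :=
      map_sub (walk d) f g
    rw [this, Pi.sub_apply, Pi.sub_apply, hfe, hge]
    ring
  -- The difference is a fixed point of ε times the walk operator, a sup-norm contraction by |ε|;
  -- iterate.
  have hn : ∀ (n : ℕ) i, |(f - g) i| ≤ |ε| ^ n * (2 * C) := by
    intro n
    induction n with
    | zero =>
      intro i
      simp only [Pi.sub_apply, pow_zero, one_mul]
      exact (abs_sub _ _).trans (by linarith [hf i, hg i])
    | succ n ih =>
      intro i
      rw [h, abs_mul, pow_succ', mul_assoc]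
      gcongr
      exact abs_neighbourAverage_le hd ih i
  ext i
  have hlim : Tendsto (fun n : ℕ => |ε| ^ n * (2 * C)) atTop (𝓝 (0 * (2 * C))) :=
    (tendsto_pow_atTop_nhds_zero_of_lt_one (abs_nonneg _) hε).mul_const _
  rw [zero_mul] at hlim
  have := ge_of_tendsto' hlim fun n => hn n i
  have h0 : (f - g) i = 0 := abs_nonpos_iff.1 this
  exact sub_eq_zero.1 h0

variable {Ω : Type*} {mΩ : MeasurableSpace Ω} {P : Measure Ω}

theorem integrable_neighbourAverage {U : Ω → Site d → ℝ} (hU : ∀ i, Integrable (fun ω => U ω i) P)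
    (i : Site d) : Integrable (fun ω => neighbourAverage (U ω) i) P :=
  (integrable_finsetSum _ fun _ _ => (hU _).add (hU _)).div_const _

theorem integral_neighbourAverage {U : Ω → Site d → ℝ} (hU : ∀ i, Integrable (fun ω => U ω i) P)
    (i : Site d) :
    ∫ ω, neighbourAverage (U ω) i ∂P = neighbourAverage (fun j => ∫ ω, U ω j ∂P) i := by
  simp only [neighbourAverage]
  have h : ∀ k, Integrable
      (fun ω => U ω (i + Pi.single k 1) + U ω (i - Pi.single k 1)) P := fun k =>
    (hU _).add (hU _)
  rw [integral_div, integral_finsetSum _ fun k _ => h k]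
  congr 1
  exact Finset.sum_congr rfl fun k _ => integral_add (hU _) (hU _)

theorem integrable_walk_pow {U : Ω → Site d → ℝ} (hU : ∀ i, Integrable (fun ω => U ω i) P)
    (n : ℕ) (i : Site d) : Integrable (fun ω => (walk d ^ n) (U ω) i) P := by
  induction n generalizing i with
  | zero => simpa using hU i
  | succ n ih =>
    simp_rw [walk_pow_succ_apply]
    exact integrable_neighbourAverage ih i

theorem integral_walk_pow {U : Ω → Site d → ℝ} (hU : ∀ i, Integrable (fun ω => U ω i) P)
    (n : ℕ) (i : Site d) :
    ∫ ω, (walk d ^ n) (U ω) i ∂P = (walk d ^ n) (fun j => ∫ ω, U ω j ∂P) i := by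
  induction n generalizing i with
  | zero => simp
  | succ n ih =>
    simp_rw [walk_pow_succ_apply]
    rw [integral_neighbourAverage (fun j => integrable_walk_pow hU n j)]
    congr 1
    ext j
    exact ih j

/-- Used pointwise in ω to absorb the second factor of a product, so that the expectation can then
pass through the power of the walk. -/
theorem walk_pow_mul_const (n : ℕ) (x : Site d → ℝ) (c : ℝ) (i : Site d) :
    (walk d ^ n) x i * c = (walk d ^ n) (fun j => x j * c) i := by
  have : (fun j => x j * c) = c • x := by
    ext j
    simp [mul_comm]
  rw [this, map_smul, Pi.smul_apply, smul_eq_mul, mul_comm]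

theorem walk_pow_walkKernel (n m : ℕ) (i j : Site d) :
    (walk d ^ n) (fun k => walkKernel m k j) i = walkKernel (n + m) i j := by
  rw [walkKernel, pow_add, Module.End.mul_apply]
  rfl

end Lattice

end GaussFactor

namespace GaussFactor

/-! ### The power series square root behind the moving average. -/

section Coefficients

open PowerSeries

/-- From one index to the next the coefficient is multiplied by (r - n)/(n + 1), of modulus at most
1 for r in [-1, 1]. -/
theorem abs_choose_le_one {r : ℝ} (h0 : -1 ≤ r) (h1 : r ≤ 1) (n : ℕ) :
    |Ring.choose r n| ≤ 1 := by
  induction n with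
  | zero => simp
  | succ n ih =>
    have h := Ring.choose_smul_choose r (Nat.le_succ n)
    simp only [Nat.succ_eq_add_one, Nat.choose_succ_self_right, add_tsub_cancel_left,
      Ring.choose_one_right, nsmul_eq_mul] at h
    have hn : (0 : ℝ) < (n + 1 : ℕ) := by positivity
    refine le_of_mul_le_mul_left ?_ hn
    rw [← abs_of_pos hn, ← abs_mul, h, abs_mul, abs_of_pos hn, mul_one]
    refine (mul_le_of_le_one_left (abs_nonneg _) ih).trans ?_
    rw [abs_le]
    push_cast
    constructor <;> linarith

/-- The power series of `((1 + x) / (2 * (1 - x))) ^ (1 / 2)`. -/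
theorem exists_sqrt_coefficients : ∃ a : ℕ → ℝ, (∀ n, |a n| ≤ 2 ^ n) ∧
    ∀ n, ∑ p ∈ Finset.HasAntidiagonal.antidiagonal n, a p.1 * a p.2 =
      if n = 0 then 1 / 2 else 1 := by
  -- A = (1+x)^(1/2), B = (1+x)^(-1/2) and D = (1-x)^(-1/2); the wanted series is AD/√2.
  let A : ℝ⟦X⟧ := binomialSeries ℝ (1 / 2 : ℝ)
  let B : ℝ⟦X⟧ := binomialSeries ℝ (-(1 / 2) : ℝ)
  let D : ℝ⟦X⟧ := rescale (-1 : ℝ) B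
  have hAA : A * A = 1 + X := by
    rw [← binomialSeries_add]
    have := binomialSeries_nat (R := ℝ) (A := ℝ) 1
    norm_num at this ⊢
    exact this
  have hAB : A * B = 1 := by
    rw [← binomialSeries_add]
    norm_num
  have hDD : D * D = mk 1 := by
    have h1 : B * B * (1 + X) = 1 := by
      rw [← hAA]
      linear_combination (A * B + 1) * hAB
    have h2 : D * D * (1 - X) = 1 := by
      have := congrArg (rescale (-1 : ℝ)) h1
      simp only [map_mul, map_add, map_one, rescale_X] at this
      rw [show (1 - X : ℝ⟦X⟧) = 1 + C (-1) * X by simp [sub_eq_add_neg]]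
      exact this
    have h3 : (mk 1 : ℝ⟦X⟧) * (1 - X) = 1 := mk_one_mul_one_sub_eq_one ℝ
    calc D * D = D * D * (mk 1 * (1 - X)) := by rw [h3, mul_one]
      _ = D * D * (1 - X) * mk 1 := by ring
      _ = mk 1 := by rw [h2, one_mul]
  have hs : (√2)⁻¹ * (√2)⁻¹ = (1 / 2 : ℝ) := by
    rw [← mul_inv, Real.mul_self_sqrt (by norm_num)]
    norm_num
  refine ⟨fun n => (√2)⁻¹ * coeff n (A * D), fun n => ?_, fun n => ?_⟩
  · have hA : ∀ k, |coeff k A| ≤ 1 := fun k => by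
      simp only [A, binomialSeries_coeff, smul_eq_mul, mul_one]
      exact abs_choose_le_one (by norm_num) (by norm_num) k
    have hD : ∀ k, |coeff k D| ≤ 1 := fun k => by
      simp only [D, B, coeff_rescale, binomialSeries_coeff, smul_eq_mul, mul_one, abs_mul, abs_pow,
        abs_neg, abs_one, one_pow, one_mul]
      exact abs_choose_le_one (by norm_num) (by norm_num) k
    have hle : |coeff n (A * D)| ≤ n + 1 := by
      rw [coeff_mul]
      refine (Finset.abs_sum_le_sum_abs _ _).trans ?_
      refine (Finset.sum_le_card_nsmul _ _ 1 fun p _ => ?_).trans (by simp)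
      rw [abs_mul]
      exact mul_le_one₀ (hA _) (abs_nonneg _) (hD _)
    have hpow : (n + 1 : ℝ) ≤ 2 ^ n := by exact_mod_cast Nat.lt_two_pow_self (n := n)
    rw [abs_mul, abs_of_nonneg (by positivity : (0 : ℝ) ≤ (√2)⁻¹)]
    refine (mul_le_of_le_one_left (abs_nonneg _) (inv_le_one_of_one_le₀ ?_)).trans
      (hle.trans hpow)
    exact Real.one_le_sqrt.2 (by norm_num)
  -- The square of AD/√2 is (1+x)/(2(1-x)) = 1/2 + x + x² + ⋯.
  · have h : ∑ p ∈ Finset.HasAntidiagonal.antidiagonal n,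
        (√2)⁻¹ * coeff p.1 (A * D) * ((√2)⁻¹ * coeff p.2 (A * D))
        = (1 / 2) * coeff n ((1 + X) * mk 1 : ℝ⟦X⟧) := by
      rw [← hAA, ← hDD, show A * A * (D * D) = (A * D) * (A * D) by ring, coeff_mul,
        Finset.mul_sum]
      refine Finset.sum_congr rfl fun p _ => ?_
      rw [← hs]
      ring
    rw [h, add_mul, one_mul, map_add]
    cases n with
    | zero => simp
    | succ n =>
      rw [coeff_succ_X_mul]
      norm_num

end Coefficients

end GaussFactor

namespace GaussFactor

open Filter Topology

/-! ### Linear combinations of Gaussian processes. -/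

section Span

variable {S T Ω : Type*} {mΩ : MeasurableSpace Ω} {P : Measure Ω}

/-- Finite linear combinations of a Gaussian process form a Gaussian process. -/
theorem isGaussianProcess_of_mem_span {X : T → Ω → ℝ} {Y : S → Ω → ℝ}
    (hX : IsGaussianProcess X P) (hY : ∀ s, Y s ∈ Submodule.span ℝ (Set.range X)) :
    IsGaussianProcess Y P := by
  refine hX.of_isGaussianProcess fun s => ?_
  obtain ⟨c, hc⟩ := Finsupp.mem_span_range_iff_exists_finsupp.1 (hY s)
  refine ⟨c.support, ∑ t : c.support, c t • ContinuousLinearMap.proj t, fun ω => ?_⟩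
  rw [← hc, Finsupp.sum, Finset.sum_apply]
  simp only [sum_apply, smul_apply,
    ContinuousLinearMap.proj_apply, Finset.restrict]
  exact (Finset.sum_coe_sort c.support fun t => c t • X t ω).symm

theorem neighbourAverage_mem {d : ℕ} {M : Submodule ℝ (Ω → ℝ)} {U : Ω → Site d → ℝ}
    (hU : ∀ i, (fun ω => U ω i) ∈ M) (i : Site d) :
    (fun ω => neighbourAverage (U ω) i) ∈ M := by
  have : (fun ω => neighbourAverage (U ω) i) = (2 * d : ℝ)⁻¹ • ∑ k : Fin d,
      ((fun ω => U ω (i + Pi.single k 1)) + fun ω => U ω (i - Pi.single k 1)) := by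
    ext ω
    simp [neighbourAverage, div_eq_inv_mul]
  rw [this]
  exact M.smul_mem _ (M.sum_mem fun k _ => M.add_mem (hU _) (hU _))

theorem walk_pow_mem {d : ℕ} {M : Submodule ℝ (Ω → ℝ)} {U : Ω → Site d → ℝ}
    (hU : ∀ i, (fun ω => U ω i) ∈ M) (n : ℕ) (i : Site d) :
    (fun ω => (walk d ^ n) (U ω) i) ∈ M := by
  induction n generalizing i with
  | zero => simpa using hU i
  | succ n ih =>
    simp_rw [walk_pow_succ_apply]
    exact neighbourAverage_mem ih i

end Span

/-! ### White noise. -/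

section Noise

variable {T : Type*}

/-- The law of a family of independent standard Gaussian variables. -/
noncomputable def whiteNoise (T : Type*) : Measure (T → ℝ) :=
  Measure.infinitePi fun _ => gaussianReal 0 1

instance : IsProbabilityMeasure (whiteNoise T) := by
  unfold whiteNoise
  infer_instance

theorem map_eval_whiteNoise (t : T) : (whiteNoise T).map (fun x => x t) = gaussianReal 0 1 :=
  Measure.infinitePi_map_eval _ t

theorem iIndepFun_whiteNoise : iIndepFun (fun (t : T) (x : T → ℝ) => x t) (whiteNoise T) :=
  iIndepFun_infinitePi (X := fun _ x => x) fun _ => measurable_id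

theorem hasGaussianLaw_whiteNoise (t : T) :
    HasGaussianLaw (fun x : T → ℝ => x t) (whiteNoise T) := by
  constructor
  rw [map_eval_whiteNoise]
  infer_instance

theorem isGaussianProcess_whiteNoise :
    IsGaussianProcess (fun (t : T) (x : T → ℝ) => x t) (whiteNoise T) := by
  refine ⟨fun I => ?_⟩
  have h : iIndepFun (fun (t : I) (x : T → ℝ) => x t) (whiteNoise T) :=
    iIndepFun_whiteNoise.precomp Subtype.val_injective
  exact h.hasGaussianLaw fun t => hasGaussianLaw_whiteNoise _

theorem integral_whiteNoise (t : T) : ∫ x, x t ∂(whiteNoise T) = 0 := by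
  have h := integral_map (μ := whiteNoise T) (measurable_pi_apply t).aemeasurable
    (f := fun x : ℝ => x) (by fun_prop)
  rw [← h, map_eval_whiteNoise, integral_id_gaussianReal]

theorem integral_sq_whiteNoise (t : T) : ∫ x, x t ^ 2 ∂(whiteNoise T) = 1 := by
  have h := integral_map (μ := whiteNoise T) (measurable_pi_apply t).aemeasurable
    (f := fun x : ℝ => x ^ 2) (by fun_prop)
  rw [← h, map_eval_whiteNoise, ← variance_of_integral_eq_zero (X := fun x => x) (by fun_prop)
    (by simp [integral_id_gaussianReal]), variance_fun_id_gaussianReal]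
  simp

theorem integral_mul_whiteNoise [DecidableEq T] (s t : T) :
    ∫ x, x s * x t ∂(whiteNoise T) = if s = t then 1 else 0 := by
  split_ifs with h
  · subst h
    simpa only [sq] using integral_sq_whiteNoise s
  · rw [(iIndepFun_whiteNoise.indepFun h).integral_fun_mul_eq_mul_integral
      (measurable_pi_apply s).aestronglyMeasurable (measurable_pi_apply t).aestronglyMeasurable,
      integral_whiteNoise, zero_mul]

theorem memLp_whiteNoise (t : T) : MemLp (fun x : T → ℝ => x t) 2 (whiteNoise T) :=
  (hasGaussianLaw_whiteNoise t).memLp_two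

theorem integrable_whiteNoise (t : T) : Integrable (fun x : T → ℝ => x t) (whiteNoise T) :=
  (hasGaussianLaw_whiteNoise t).integrable

theorem integral_abs_whiteNoise_le (t : T) : ∫ x, |x t| ∂(whiteNoise T) ≤ 1 := by
  have h : ∫ x, |x t| ∂(whiteNoise T) ≤ ∫ x, (1 + x t ^ 2) / 2 ∂(whiteNoise T) := by
    refine integral_mono (integrable_whiteNoise t).abs
      (((integrable_const _).add (memLp_whiteNoise t).integrable_sq).div_const _) fun x => ?_
    have := sq_nonneg (|x t| - 1)
    simp only
    nlinarith [sq_abs (x t)]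
  refine h.trans (le_of_eq ?_)
  rw [integral_div, integral_add (integrable_const _) (memLp_whiteNoise t).integrable_sq,
    integral_sq_whiteNoise]
  simp

end Noise

/-! ### Moving averages of white noise: convergence and tail estimates. -/

section MovingAverage

variable {d : ℕ} {a : ℕ → ℝ} {ε : ℝ}

/-- The truncated moving average `∑ n < N, a n ε ^ n P ^ n ξ`, with `P` the random walk operator. -/
noncomputable def partialAverage (a : ℕ → ℝ) (ε : ℝ) (N : ℕ) (ξ : Site d → ℝ) (i : Site d) : ℝ :=
  ∑ n ∈ Finset.range N, a n * ε ^ n * (walk d ^ n) ξ i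

/-- The moving average `∑ n, a n ε ^ n P ^ n ξ`. -/
noncomputable def fullAverage (a : ℕ → ℝ) (ε : ℝ) (ξ : Site d → ℝ) (i : Site d) : ℝ :=
  limsup (fun N => partialAverage a ε N ξ i) atTop

theorem measurable_walk_pow (n : ℕ) (i : Site d) :
    Measurable fun ξ : Site d → ℝ => (walk d ^ n) ξ i := by
  induction n generalizing i with
  | zero => simpa using measurable_pi_apply i
  | succ n ih =>
    simp_rw [walk_pow_succ_apply, neighbourAverage]
    exact (Finset.measurable_fun_sum _ fun k _ => (ih _).add (ih _)).div_const _

theorem measurable_partialAverage (N : ℕ) :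
    Measurable (partialAverage a ε N : (Site d → ℝ) → Site d → ℝ) :=
  measurable_pi_lambda _ fun i => Finset.measurable_fun_sum _ fun n _ =>
    (measurable_walk_pow n i).const_mul _

theorem measurable_fullAverage : Measurable (fullAverage a ε : (Site d → ℝ) → Site d → ℝ) :=
  measurable_pi_lambda _ fun i => Measurable.limsup fun N =>
    (measurable_pi_apply i).comp (measurable_partialAverage N)

theorem partialAverage_shift (N : ℕ) (v : Site d) (ξ : Site d → ℝ) :
    partialAverage a ε N (shift v ξ) = shift v (partialAverage a ε N ξ) := by
  ext i
  simp only [partialAverage, walk_pow_shift]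
  rfl

/-- Holds for every configuration, even where the series diverges, because the limsup is taken of
equal sequences. A factor map has to commute with translations everywhere, not just almost surely.
-/
theorem fullAverage_shift (v : Site d) (ξ : Site d → ℝ) :
    fullAverage a ε (shift v ξ) = shift v (fullAverage a ε ξ) := by
  ext i
  simp only [fullAverage, partialAverage_shift]
  rfl

/-- The walk averages with nonnegative weights of total mass one, so it does not increase a uniform
bound on first absolute moments. -/
theorem integral_abs_walk_pow_whiteNoise_le (hd : 1 ≤ d) (n : ℕ) (i : Site d) :
    ∫ ξ, |(walk d ^ n) ξ i| ∂(whiteNoise (Site d)) ≤ 1 := by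
  have hI : ∀ j : Site d, Integrable (fun ξ : Site d → ℝ => |ξ j|) (whiteNoise (Site d)) :=
    fun j => (integrable_whiteNoise j).abs
  have h : ∫ ξ, |(walk d ^ n) ξ i| ∂(whiteNoise (Site d))
      ≤ ∫ ξ, (walk d ^ n) (fun j => |ξ j|) i ∂(whiteNoise (Site d)) :=
    integral_mono (integrable_walk_pow integrable_whiteNoise n i).abs (integrable_walk_pow hI n i)
      fun ξ => abs_walk_pow_le_walk_pow_abs ξ n i
  refine h.trans ?_
  rw [integral_walk_pow hI]
  refine (le_abs_self _).trans (abs_walk_pow_le hd (fun j => ?_) n i)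
  rw [abs_of_nonneg (integral_nonneg fun ξ => abs_nonneg _)]
  exact integral_abs_whiteNoise_le j

theorem abs_coefficient_le (ha : ∀ n, |a n| ≤ 2 ^ n) (hε : |ε| ≤ 1 / 8) (n : ℕ) :
    |a n * ε ^ n| ≤ (1 / 4) ^ n := by
  rw [abs_mul, abs_pow, show (1 / 4 : ℝ) = 2 * (1 / 8) by norm_num, mul_pow]
  gcongr
  exact ha n

theorem lintegral_term_le (hd : 1 ≤ d) (ha : ∀ n, |a n| ≤ 2 ^ n) (hε : |ε| ≤ 1 / 8) (n : ℕ)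
    (i : Site d) :
    ∫⁻ ξ, ‖a n * ε ^ n * (walk d ^ n) ξ i‖ₑ ∂(whiteNoise (Site d))
      ≤ ENNReal.ofReal ((1 / 4) ^ n) := by
  have hI : Integrable (fun ξ : Site d → ℝ => a n * ε ^ n * (walk d ^ n) ξ i)
      (whiteNoise (Site d)) := (integrable_walk_pow integrable_whiteNoise n i).const_mul _
  rw [← ofReal_integral_norm_eq_lintegral_enorm hI]
  refine ENNReal.ofReal_le_ofReal ?_
  simp_rw [norm_mul _ ((walk d ^ n) _ i), integral_const_mul, Real.norm_eq_abs]
  refine (mul_le_mul (abs_coefficient_le ha hε n) (integral_abs_walk_pow_whiteNoise_le hd n i)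
    (integral_nonneg fun ξ => abs_nonneg _) (by positivity)).trans (by rw [mul_one])

/-- The L¹ norms of the terms are dominated by a convergent geometric series. -/
theorem ae_summable_term (hd : 1 ≤ d) (ha : ∀ n, |a n| ≤ 2 ^ n) (hε : |ε| ≤ 1 / 8)
    (i : Site d) : ∀ᵐ ξ ∂(whiteNoise (Site d)),
      Summable fun n => a n * ε ^ n * (walk d ^ n) ξ i := by
  have h := summable_norm_of_tsum_eLpNorm_ne_top (μ := whiteNoise (Site d)) (p := 1) le_rfl
    (f := fun n ξ => a n * ε ^ n * (walk d ^ n) ξ i)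
    (fun n => ((measurable_walk_pow n i).const_mul _).aestronglyMeasurable) ?_
  · filter_upwards [h] with ξ hξ using hξ.of_norm
  · simp_rw [eLpNorm_one_eq_lintegral_enorm]
    refine ne_top_of_le_ne_top ?_ (ENNReal.tsum_le_tsum fun n => lintegral_term_le hd ha hε n i)
    rw [← ENNReal.ofReal_tsum_of_nonneg (fun n => by positivity)
      (summable_geometric_of_lt_one (by norm_num) (by norm_num))]
    exact ENNReal.ofReal_ne_top

theorem fullAverage_eq_tsum {ξ : Site d → ℝ} {i : Site d}
    (h : Summable fun n => a n * ε ^ n * (walk d ^ n) ξ i) :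
    fullAverage a ε ξ i = ∑' n, a n * ε ^ n * (walk d ^ n) ξ i :=
  h.hasSum.tendsto_sum_nat.limsup_eq

theorem ae_tendsto_partialAverage (hd : 1 ≤ d) (ha : ∀ n, |a n| ≤ 2 ^ n) (hε : |ε| ≤ 1 / 8)
    (i : Site d) : ∀ᵐ ξ ∂(whiteNoise (Site d)),
      Tendsto (fun N => partialAverage a ε N ξ i) atTop (𝓝 (fullAverage a ε ξ i)) := by
  filter_upwards [ae_summable_term hd ha hε i] with ξ hξ
  rw [fullAverage_eq_tsum hξ]
  exact hξ.hasSum.tendsto_sum_nat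

theorem lintegral_fullAverage_sub_partialAverage_le (hd : 1 ≤ d) (ha : ∀ n, |a n| ≤ 2 ^ n)
    (hε : |ε| ≤ 1 / 8) (N : ℕ) (i : Site d) :
    ∫⁻ ξ, ‖fullAverage a ε ξ i - partialAverage a ε N ξ i‖ₑ ∂(whiteNoise (Site d))
      ≤ ENNReal.ofReal (4 / 3 * (1 / 4) ^ N) := by
  calc ∫⁻ ξ, ‖fullAverage a ε ξ i - partialAverage a ε N ξ i‖ₑ ∂(whiteNoise (Site d))
      ≤ ∫⁻ ξ, ∑' n, ‖a (n + N) * ε ^ (n + N) * (walk d ^ (n + N)) ξ i‖ₑ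
          ∂(whiteNoise (Site d)) := by
        refine lintegral_mono_ae ?_
        filter_upwards [ae_summable_term hd ha hε i] with ξ hξ
        rw [fullAverage_eq_tsum hξ, partialAverage, ← hξ.sum_add_tsum_nat_add N,
          add_sub_cancel_left]
        exact enorm_tsum_le_tsum_enorm
    _ = ∑' n, ∫⁻ ξ, ‖a (n + N) * ε ^ (n + N) * (walk d ^ (n + N)) ξ i‖ₑ
          ∂(whiteNoise (Site d)) :=
        lintegral_tsum fun n => ((measurable_walk_pow _ i).const_mul _).enorm.aemeasurable
    _ ≤ ∑' n, ENNReal.ofReal ((1 / 4) ^ (n + N)) :=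
        ENNReal.tsum_le_tsum fun n => lintegral_term_le hd ha hε _ i
    _ = ENNReal.ofReal (4 / 3 * (1 / 4) ^ N) := by
        have hs : HasSum (fun n => (1 / 4 : ℝ) ^ (n + N)) (4 / 3 * (1 / 4) ^ N) := by
          simp_rw [pow_add]
          rw [show (4 / 3 : ℝ) = (1 - 1 / 4)⁻¹ by norm_num]
          exact (hasSum_geometric_of_lt_one (by norm_num) (by norm_num)).mul_right _
        rw [← ENNReal.ofReal_tsum_of_nonneg (fun n => by positivity) hs.summable, hs.tsum_eq]

end MovingAverage

end GaussFactor

namespace GaussFactor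

open Filter Topology

/-! ### The constructed field and its covariance. -/

section Field

theorem integrable_fun_mul {Ω : Type*} {mΩ : MeasurableSpace Ω} {P : Measure Ω} {f g : Ω → ℝ}
    (hf : MemLp f 2 P) (hg : MemLp g 2 P) : Integrable (fun ω => f ω * g ω) P :=
  hf.integrable_mul hg

variable {d : ℕ} {a : ℕ → ℝ} {ε : ℝ}

/-- The truncated moving average field driven by the noise `ω (·, false)`, plus the independent
noise `ω (·, true) / √2`. -/
noncomputable def truncField (a : ℕ → ℝ) (ε : ℝ) (N : ℕ) (ω : Site d × Bool → ℝ) (i : Site d) : ℝ :=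
  (√2)⁻¹ * ω (i, true) + partialAverage a ε N (fun j => ω (j, false)) i

/-- The moving average field driven by the noise `ω (·, false)`, plus the independent noise
`ω (·, true) / √2`. -/
noncomputable def limitField (a : ℕ → ℝ) (ε : ℝ) (ω : Site d × Bool → ℝ) (i : Site d) : ℝ :=
  (√2)⁻¹ * ω (i, true) + fullAverage a ε (fun j => ω (j, false)) i

theorem measurable_truncField (N : ℕ) :
    Measurable (truncField a ε N : (Site d × Bool → ℝ) → Site d → ℝ) := by
  refine measurable_pi_lambda _ fun i => ((measurable_pi_apply _).const_mul _).add ?_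
  exact (measurable_pi_apply i).comp ((measurable_partialAverage N).comp
    (measurable_pi_lambda _ fun j => measurable_pi_apply _))

theorem measurable_limitField :
    Measurable (limitField a ε : (Site d × Bool → ℝ) → Site d → ℝ) := by
  refine measurable_pi_lambda _ fun i => ((measurable_pi_apply _).const_mul _).add ?_
  exact (measurable_pi_apply i).comp (measurable_fullAverage.comp
    (measurable_pi_lambda _ fun j => measurable_pi_apply _))

theorem map_whiteNoise_of_injective {S T : Type*} {f : S → T} (hf : Function.Injective f) :
    (whiteNoise T).map (fun ω s => ω (f s)) = whiteNoise S :=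
  Measure.map_infinitePi_infinitePi_of_inj hf

theorem ae_tendsto_truncField (hd : 1 ≤ d) (ha : ∀ n, |a n| ≤ 2 ^ n) (hε : |ε| ≤ 1 / 8)
    (i : Site d) : ∀ᵐ ω ∂(whiteNoise (Site d × Bool)),
      Tendsto (fun N => truncField a ε N ω i) atTop (𝓝 (limitField a ε ω i)) := by
  have h := ae_tendsto_partialAverage hd ha hε i
  rw [← map_whiteNoise_of_injective (Prod.mk_left_injective false)] at h
  filter_upwards [ae_of_ae_map (measurable_pi_lambda _ fun j =>
    measurable_pi_apply _).aemeasurable h] with ω hω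
  exact hω.const_add _

theorem eval_mem_span {T : Type*} (t : T) :
    (fun x : T → ℝ => x t) ∈ Submodule.span ℝ (Set.range fun (t : T) (x : T → ℝ) => x t) :=
  Submodule.subset_span ⟨t, rfl⟩

theorem truncField_mem_span (N : ℕ) (i : Site d) :
    (fun ω : Site d × Bool → ℝ => truncField a ε N ω i) ∈
      Submodule.span ℝ (Set.range fun (p : Site d × Bool) (ω : Site d × Bool → ℝ) => ω p) := by
  have : (fun ω : Site d × Bool → ℝ => truncField a ε N ω i) =
      (√2)⁻¹ • (fun ω : Site d × Bool → ℝ => ω (i, true)) + ∑ n ∈ Finset.range N,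
        (a n * ε ^ n) • fun ω : Site d × Bool → ℝ => (walk d ^ n) (fun j => ω (j, false)) i := by
    ext ω
    simp [truncField, partialAverage]
  rw [this]
  exact Submodule.add_mem _ (Submodule.smul_mem _ _ (eval_mem_span _))
    (Submodule.sum_mem _ fun n _ =>
      Submodule.smul_mem _ _ (walk_pow_mem (fun j => eval_mem_span _) n i))

theorem isGaussianProcess_truncField (N : ℕ) :
    IsGaussianProcess (fun (i : Site d) ω => truncField a ε N ω i)
      (whiteNoise (Site d × Bool)) :=
  isGaussianProcess_of_mem_span isGaussianProcess_whiteNoise (truncField_mem_span N)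

theorem integral_truncField (N : ℕ) (i : Site d) :
    ∫ ω, truncField a ε N ω i ∂(whiteNoise (Site d × Bool)) = 0 := by
  have hI : ∀ n, Integrable (fun ω : Site d × Bool → ℝ =>
      a n * ε ^ n * (walk d ^ n) (fun j => ω (j, false)) i) (whiteNoise (Site d × Bool)) :=
    fun n => (integrable_walk_pow (fun j => integrable_whiteNoise _) n i).const_mul _
  simp only [truncField, partialAverage]
  rw [integral_add ((integrable_whiteNoise _).const_mul _) (integrable_finsetSum _ fun n _ => hI n),
    integral_finsetSum _ fun n _ => hI n, integral_const_mul, integral_whiteNoise, mul_zero,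
    zero_add]
  refine Finset.sum_eq_zero fun n _ => ?_
  rw [integral_const_mul, integral_walk_pow (fun j => integrable_whiteNoise _)]
  simp_rw [integral_whiteNoise]
  rw [show (fun _ : Site d => (0 : ℝ)) = 0 from rfl, map_zero, Pi.zero_apply, mul_zero]

theorem memLp_walk_pow_whiteNoise (n : ℕ) (i : Site d) :
    MemLp (fun ω : Site d × Bool → ℝ => (walk d ^ n) (fun j => ω (j, false)) i) 2
      (whiteNoise (Site d × Bool)) := by
  have h : IsGaussianProcess (fun (i : Site d) (ω : Site d × Bool → ℝ) =>
      (walk d ^ n) (fun j => ω (j, false)) i) (whiteNoise (Site d × Bool)) :=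
    isGaussianProcess_of_mem_span isGaussianProcess_whiteNoise fun i =>
      walk_pow_mem (U := fun (ω : Site d × Bool → ℝ) j => ω (j, false))
        (fun j => eval_mem_span (j, false)) n i
  exact (h.hasGaussianLaw_eval i).memLp_two

theorem integral_coordinate_mul_walk_pow (n : ℕ) (p : Site d × Bool) (j : Site d) :
    ∫ ω, ω p * (walk d ^ n) (fun k => ω (k, false)) j ∂(whiteNoise (Site d × Bool))
      = if p.2 then 0 else walkKernel n p.1 j := by
  classical
  simp_rw [mul_comm _ ((walk d ^ n) _ j), walk_pow_mul_const]
  rw [integral_walk_pow fun k => integrable_fun_mul (memLp_whiteNoise _) (memLp_whiteNoise _)]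
  obtain ⟨i, b⟩ := p
  simp_rw [integral_mul_whiteNoise, Prod.mk.injEq]
  cases b
  · rw [walkKernel_symm, walkKernel]
    simp only [and_true, Bool.false_eq_true, if_false]
    refine congrFun (congrArg (walk d ^ n) (funext fun k => ?_)) j
    simp [Pi.single_apply]
  · simp only [Bool.false_eq_true, and_false, if_false, if_true]
    rw [show (fun _ : Site d => (0 : ℝ)) = 0 from rfl, map_zero, Pi.zero_apply]

/-- White noise has identity covariance and P is symmetric, so the covariance of P^n ξ and P^m ξ is
P^(n+m). -/
theorem integral_walk_pow_mul_walk_pow (n m : ℕ) (i j : Site d) :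
    ∫ ω, (walk d ^ n) (fun k => ω (k, false)) i * (walk d ^ m) (fun k => ω (k, false)) j
      ∂(whiteNoise (Site d × Bool)) = walkKernel (n + m) i j := by
  simp_rw [walk_pow_mul_const]
  rw [integral_walk_pow fun k => integrable_fun_mul (memLp_whiteNoise _)
    (memLp_walk_pow_whiteNoise m j)]
  simp_rw [integral_coordinate_mul_walk_pow]
  exact walk_pow_walkKernel n m i j

theorem integral_truncField_mul_truncField (N : ℕ) (i j : Site d) :
    ∫ ω, truncField a ε N ω i * truncField a ε N ω j ∂(whiteNoise (Site d × Bool))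
      = (1 / 2) * walkKernel 0 i j + ∑ p ∈ Finset.range N ×ˢ Finset.range N,
          a p.1 * a p.2 * ε ^ (p.1 + p.2) * walkKernel (p.1 + p.2) i j := by
  classical
  set P := whiteNoise (Site d × Bool)
  set W : ℕ → Site d → (Site d × Bool → ℝ) → ℝ := fun n i ω =>
    a n * ε ^ n * (walk d ^ n) (fun k => ω (k, false)) i with hW
  set S : Site d → (Site d × Bool → ℝ) → ℝ := fun i ω => ∑ n ∈ Finset.range N, W n i ω with hS
  set H : Site d → (Site d × Bool → ℝ) → ℝ := fun i ω => (√2)⁻¹ * ω (i, true) with hH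
  have hWL : ∀ n i, MemLp (W n i) 2 P := fun n i => (memLp_walk_pow_whiteNoise n i).const_mul _
  have hSL : ∀ i, MemLp (S i) 2 P := fun i => memLp_finsetSum _ fun n _ => hWL n i
  have hHL : ∀ i, MemLp (H i) 2 P := fun i => (memLp_whiteNoise _).const_mul _
  have hHH : ∫ ω, H i ω * H j ω ∂P = (1 / 2) * walkKernel 0 i j := by
    have : ∀ ω, H i ω * H j ω = (1 / 2) * (ω (i, true) * ω (j, true)) := by
      intro ω
      have hs : (√2)⁻¹ * (√2)⁻¹ = (1 / 2 : ℝ) := by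
        rw [← mul_inv, Real.mul_self_sqrt (by norm_num)]
        norm_num
      rw [← hs]
      simp only [hH]
      ring
    simp_rw [this, integral_const_mul]
    rw [integral_mul_whiteNoise, walkKernel_zero]
    simp
  have hHS : ∀ i j, ∫ ω, H i ω * S j ω ∂P = 0 := by
    intro i j
    simp_rw [hS, Finset.mul_sum]
    rw [integral_finsetSum _ fun n _ => integrable_fun_mul (hHL i) (hWL n j)]
    refine Finset.sum_eq_zero fun n _ => ?_
    have : ∀ ω, H i ω * W n j ω = (√2)⁻¹ * (a n * ε ^ n) *
        (ω (i, true) * (walk d ^ n) (fun k => ω (k, false)) j) := fun ω => by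
      simp only [hH, hW]
      ring
    simp_rw [this, integral_const_mul]
    rw [integral_coordinate_mul_walk_pow]
    simp
  have hSS : ∫ ω, S i ω * S j ω ∂P = ∑ p ∈ Finset.range N ×ˢ Finset.range N,
      a p.1 * a p.2 * ε ^ (p.1 + p.2) * walkKernel (p.1 + p.2) i j := by
    simp_rw [hS, Finset.sum_mul_sum, ← Finset.sum_product']
    rw [integral_finsetSum _ fun p _ => integrable_fun_mul (hWL p.1 i) (hWL p.2 j)]
    refine Finset.sum_congr rfl fun p _ => ?_
    have : ∀ ω, W p.1 i ω * W p.2 j ω = a p.1 * a p.2 * ε ^ (p.1 + p.2) *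
        ((walk d ^ p.1) (fun k => ω (k, false)) i * (walk d ^ p.2) (fun k => ω (k, false)) j) :=
      fun ω => by
        simp only [hW]
        ring
    simp_rw [this, integral_const_mul]
    rw [integral_walk_pow_mul_walk_pow]
  have e : ∀ ω, truncField a ε N ω i * truncField a ε N ω j
      = (H i ω * H j ω + H i ω * S j ω) + (H j ω * S i ω + S i ω * S j ω) := fun ω => by
    simp only [truncField, partialAverage, hH, hS, hW]
    ring
  have i1 : Integrable (fun ω => H i ω * H j ω) P := (hHL i).integrable_mul (hHL j)
  have i2 : Integrable (fun ω => H i ω * S j ω) P := (hHL i).integrable_mul (hSL j)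
  have i3 : Integrable (fun ω => H j ω * S i ω) P := (hHL j).integrable_mul (hSL i)
  have i4 : Integrable (fun ω => S i ω * S j ω) P := (hSL i).integrable_mul (hSL j)
  have i12 : Integrable (fun ω => H i ω * H j ω + H i ω * S j ω) P := i1.add i2
  have i34 : Integrable (fun ω => H j ω * S i ω + S i ω * S j ω) P := i3.add i4
  simp_rw [e]
  rw [integral_add i12 i34, integral_add i1 i2, integral_add i3 i4, hHH, hHS, hHS, hSS]
  ring

theorem hasSum_double_series (hd : 1 ≤ d) (ha : ∀ n, |a n| ≤ 2 ^ n)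
    (hconv : ∀ n, ∑ p ∈ Finset.HasAntidiagonal.antidiagonal n, a p.1 * a p.2 =
      if n = 0 then 1 / 2 else 1) (hε : |ε| ≤ 1 / 8) (i j : Site d) :
    HasSum (fun p : ℕ × ℕ => a p.1 * a p.2 * ε ^ (p.1 + p.2) * walkKernel (p.1 + p.2) i j)
      (green ε i j - (1 / 2) * walkKernel 0 i j) := by
  set f : ℕ × ℕ → ℝ := fun p => a p.1 * a p.2 * ε ^ (p.1 + p.2) * walkKernel (p.1 + p.2) i j
  have hgeo : Summable fun n : ℕ => (1 / 4 : ℝ) ^ n :=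
    summable_geometric_of_lt_one (by norm_num) (by norm_num)
  have hf : Summable f := by
    refine .of_norm_bounded (hgeo.mul_of_nonneg hgeo (fun n => by positivity)
      fun n => by positivity) fun p => ?_
    have e : f p = (a p.1 * ε ^ p.1) * (a p.2 * ε ^ p.2) * walkKernel (p.1 + p.2) i j := by
      simp only [f]
      ring
    rw [e, Real.norm_eq_abs, abs_mul, abs_mul]
    refine (mul_le_of_le_one_right (by positivity) (abs_walkKernel_le hd _ i j)).trans ?_
    exact mul_le_mul (abs_coefficient_le ha hε _) (abs_coefficient_le ha hε _) (abs_nonneg _)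
      (by positivity)
  -- Regroup the absolutely convergent double series by n = p.1 + p.2, where `hconv` evaluates the
  -- inner sums.
  have h1 := (Finset.HasAntidiagonal.sigmaAntidiagonalEquivProd.hasSum_iff.2 hf.hasSum).sigma
    fun n => hasSum_fintype _
  -- The square supplies only half of the n = 0 term of the Green function; the other half is the
  -- covariance of η/√2.
  have h2 : HasSum (fun n => ε ^ n * walkKernel n i j - if n = 0 then (1 / 2) * walkKernel 0 i j
      else 0) (green ε i j - (1 / 2) * walkKernel 0 i j) :=
    (summable_green hd (by linarith) i j).hasSum.sub (hasSum_ite_eq 0 _)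
  have h3 : (fun n => ∑ c : Finset.HasAntidiagonal.antidiagonal n,
      (f ∘ Finset.HasAntidiagonal.sigmaAntidiagonalEquivProd) ⟨n, c⟩) =
      fun n => ε ^ n * walkKernel n i j - if n = 0 then (1 / 2) * walkKernel 0 i j else 0 := by
    ext n
    have e : ∀ c : Finset.HasAntidiagonal.antidiagonal n,
        (f ∘ Finset.HasAntidiagonal.sigmaAntidiagonalEquivProd) ⟨n, c⟩
          = a c.1.1 * a c.1.2 * (ε ^ n * walkKernel n i j) := by
      rintro ⟨⟨k, m⟩, hc⟩
      have hc' : k + m = n := Finset.HasAntidiagonal.mem_antidiagonal.1 hc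
      subst hc'
      simp only [Function.comp_apply, Finset.HasAntidiagonal.sigmaAntidiagonalEquivProd_apply, f]
      ring
    simp_rw [e]
    rw [Finset.sum_coe_sort (Finset.HasAntidiagonal.antidiagonal n)
      fun p => a p.1 * a p.2 * (ε ^ n * walkKernel n i j), ← Finset.sum_mul, hconv]
    split_ifs with hn
    · subst hn
      ring
    · ring
  rw [h3] at h1
  rw [← h1.unique h2]
  exact hf.hasSum

theorem tendsto_integral_truncField (hd : 1 ≤ d) (ha : ∀ n, |a n| ≤ 2 ^ n)
    (hconv : ∀ n, ∑ p ∈ Finset.HasAntidiagonal.antidiagonal n, a p.1 * a p.2 =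
      if n = 0 then 1 / 2 else 1) (hε : |ε| ≤ 1 / 8) (i j : Site d) :
    Tendsto (fun N => ∫ ω, truncField a ε N ω i * truncField a ε N ω j
      ∂(whiteNoise (Site d × Bool))) atTop (𝓝 (green ε i j)) := by
  simp_rw [integral_truncField_mul_truncField]
  have hsq : Tendsto (fun N : ℕ => Finset.range N ×ˢ Finset.range N) atTop atTop := by
    refine tendsto_atTop_finset_of_monotone (fun M N h => ?_) fun p => ⟨p.1 + p.2 + 1, ?_⟩
    · exact Finset.product_subset_product (Finset.range_mono h) (Finset.range_mono h)
    · simp only [Finset.mem_product, Finset.mem_range]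
      omega
  have h := ((hasSum_double_series hd ha hconv hε i j).comp hsq).const_add
    ((1 / 2) * walkKernel 0 i j)
  rwa [add_sub_cancel] at h

theorem isGaussianProcess_limitField (hd : 1 ≤ d) (ha : ∀ n, |a n| ≤ 2 ^ n)
    (hconv : ∀ n, ∑ p ∈ Finset.HasAntidiagonal.antidiagonal n, a p.1 * a p.2 =
      if n = 0 then 1 / 2 else 1) (hε : |ε| ≤ 1 / 8) :
    IsGaussianProcess (fun (i : Site d) ω => limitField a ε ω i) (whiteNoise (Site d × Bool)) ∧
      (∀ i : Site d, ∫ ω, limitField a ε ω i ∂(whiteNoise (Site d × Bool)) = 0) ∧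
      ∀ i j : Site d, ∫ ω, limitField a ε ω i * limitField a ε ω j ∂(whiteNoise (Site d × Bool))
        = green ε i j :=
  isGaussianProcess_of_tendsto isGaussianProcess_truncField integral_truncField
    (fun i => (measurable_pi_apply i).comp measurable_limitField)
    (ae_tendsto_truncField hd ha hε) (tendsto_integral_truncField hd ha hconv hε)

end Field

end GaussFactor

namespace GaussFactor

open Filter Topology

/-! ### Conditional laws and the resolvent equation for the covariance. -/

section Markov

variable {d : ℕ} {ε : ℝ}

/-- A Gaussian kernel with variance `1` and mean `m` is a standard Gaussian shifted by `m`. -/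
theorem compProd_gaussianReal {β : Type*} [MeasurableSpace β] (ρ : Measure β) [SFinite ρ]
    {m : β → ℝ} (hm : Measurable m) {κ : Kernel β ℝ} [IsSFiniteKernel κ]
    (hκ : ∀ y, κ y = gaussianReal (m y) 1) :
    ρ ⊗ₘ κ = (ρ.prod (gaussianReal 0 1)).map fun p => (p.1, p.2 + m p.1) := by
  ext s hs
  have hf : Measurable fun p : β × ℝ => (p.1, p.2 + m p.1) := by fun_prop
  rw [Measure.compProd_apply hs, Measure.map_apply hf hs, Measure.prod_apply (hf hs)]
  refine lintegral_congr fun y => ?_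
  have hg := gaussianReal_map_add_const (μ := 0) (v := 1) (m y)
  rw [zero_add] at hg
  rw [hκ, ← hg, Measure.map_apply (by fun_prop) (measurable_prodMk_left hs)]
  rfl

/-- The value of the field at `i` minus its prediction by the neighbours. -/
noncomputable def residual (ε : ℝ) (i : Site d) (x : Site d → ℝ) : ℝ :=
  x i - ε * neighbourAverage x i

/-- The values of the field at the sites different from `i`. -/
def others (i : Site d) (x : Site d → ℝ) (j : {j : Site d // j ≠ i}) : ℝ := x j

theorem measurable_others (i : Site d) : Measurable (others i) :=
  measurable_pi_lambda _ fun _ => measurable_pi_apply _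

theorem measurable_neighbourAverage (i : Site d) :
    Measurable fun x : Site d → ℝ => neighbourAverage x i := by
  unfold neighbourAverage
  fun_prop

theorem measurable_residual (i : Site d) : Measurable (residual ε i) :=
  (measurable_pi_apply i).sub ((measurable_neighbourAverage i).const_mul ε)

theorem add_single_ne (i : Site d) (k : Fin d) : i + Pi.single k 1 ≠ i := by
  rw [ne_eq, add_eq_left, Pi.single_eq_zero_iff]
  exact one_ne_zero

theorem sub_single_ne (i : Site d) (k : Fin d) : i - Pi.single k 1 ≠ i := by
  rw [ne_eq, sub_eq_self, Pi.single_eq_zero_iff]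
  exact one_ne_zero

/-- The prediction of the value at `i`, as a function of the values at the other sites. -/
noncomputable def prediction (ε : ℝ) (i : Site d) (y : {j : Site d // j ≠ i} → ℝ) : ℝ :=
  ε * ((∑ k : Fin d, (y ⟨_, add_single_ne i k⟩ + y ⟨_, sub_single_ne i k⟩)) / (2 * d))

theorem prediction_others (i : Site d) (x : Site d → ℝ) :
    prediction ε i (others i x) = ε * neighbourAverage x i := rfl

theorem measurable_prediction (i : Site d) : Measurable (prediction ε i) := by
  unfold prediction
  fun_prop

/-- The conditional law at `i` is the prescribed Gaussian if and only if the residual at `i` is a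
standard Gaussian variable independent of the other values. -/
theorem conditional_iff (μ : Measure (Site d → ℝ)) [IsProbabilityMeasure μ] (i : Site d) :
    (∀ᵐ ξ ∂μ, condDistrib (fun x : Site d → ℝ => x i)
        (fun (x : Site d → ℝ) (j : {j : Site d // j ≠ i}) => x j) μ (fun j => ξ j)
      = gaussianReal (ε * neighbourAverage ξ i) 1) ↔
    IndepFun (others i) (residual ε i) μ ∧ μ.map (residual ε i) = gaussianReal 0 1 := by
  have hm := measurable_prediction (ε := ε) i
  have ho := measurable_others i
  have hr := measurable_residual (ε := ε) i
  let κ : Kernel ({j : Site d // j ≠ i} → ℝ) ℝ :=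
    ⟨fun y => gaussianReal (prediction ε i y) 1,
      measurable_gaussianReal.comp (hm.prodMk measurable_const)⟩
  have hκ : ∀ y, κ y = gaussianReal (prediction ε i y) 1 := fun _ => rfl
  have : IsMarkovKernel κ := ⟨fun y => by rw [hκ]; infer_instance⟩
  have hμo : IsProbabilityMeasure (μ.map (others i)) :=
    Measure.isProbabilityMeasure_map ho.aemeasurable
  have hcomp := compProd_gaussianReal (μ.map (others i)) hm hκ
  have hshift : Measurable fun p : ({j : Site d // j ≠ i} → ℝ) × ℝ =>
      (p.1, p.2 + prediction ε i p.1) := by fun_prop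
  have hback : Measurable fun p : ({j : Site d // j ≠ i} → ℝ) × ℝ =>
      (p.1, p.2 - prediction ε i p.1) := by fun_prop
  have hpair : μ.map (fun x => (others i x, x i)) =
      (μ.map fun x => (others i x, residual ε i x)).map
        fun p => (p.1, p.2 + prediction ε i p.1) := by
    rw [Measure.map_map hshift (ho.prodMk hr)]
    congr 1
    ext x : 1
    simp [residual, prediction_others]
  have hpair' : μ.map (fun x => (others i x, residual ε i x)) =
      (μ.map fun x => (others i x, x i)).map fun p => (p.1, p.2 - prediction ε i p.1) := by
    rw [Measure.map_map hback (ho.prodMk (measurable_pi_apply i))]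
    congr 1
  constructor
  · intro h
    -- The hypothesis identifies the disintegration kernel almost everywhere. Shearing the last
    -- coordinate by the prediction then turns this joint law into a product.
    have h1 : μ.map (fun x => (others i x, x i)) = μ.map (others i) ⊗ₘ κ := by
      rw [← compProd_map_condDistrib (X := others i) (measurable_pi_apply i).aemeasurable]
      ext s hs
      rw [Measure.compProd_apply hs, Measure.compProd_apply hs,
        lintegral_map (Kernel.measurable_kernel_prodMk_left hs) ho,
        lintegral_map (Kernel.measurable_kernel_prodMk_left hs) ho]
      refine lintegral_congr_ae ?_
      filter_upwards [h] with x hx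
      rw [hκ, prediction_others, ← hx]
      rfl
    have h2 : μ.map (fun x => (others i x, residual ε i x))
        = (μ.map (others i)).prod (gaussianReal 0 1) := by
      rw [hpair', h1, hcomp, Measure.map_map hback hshift]
      convert Measure.map_id
      ext p : 1
      simp
    have h3 : μ.map (residual ε i) = gaussianReal 0 1 := by
      have := congrArg Measure.snd h2
      rwa [Measure.snd_map_prodMk ho, Measure.snd_prod] at this
    refine ⟨?_, h3⟩
    rw [indepFun_iff_map_prod_eq_prod_map_map ho.aemeasurable hr.aemeasurable, h3]
    exact h2
  · rintro ⟨hind, hlaw⟩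
    have h1 : μ.map (fun x => (others i x, x i)) = μ.map (others i) ⊗ₘ κ := by
      rw [hpair, hcomp,
        (indepFun_iff_map_prod_eq_prod_map_map ho.aemeasurable hr.aemeasurable).1 hind, hlaw]
    have h2 := condDistrib_ae_eq_of_measure_eq_compProd (others i)
      (measurable_pi_apply i).aemeasurable h1
    filter_upwards [ae_of_ae_map ho.aemeasurable h2] with x hx
    rw [← prediction_others, ← hκ, ← hx]
    rfl

theorem neighbourAverage_mul_const (x : Site d → ℝ) (c : ℝ) (i : Site d) :
    neighbourAverage x i * c = neighbourAverage (fun j => x j * c) i := by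
  simpa [walk_apply] using walk_pow_mul_const 1 x c i

theorem integral_residual_mul {μ : Measure (Site d → ℝ)}
    (hL : ∀ i, MemLp (fun x : Site d → ℝ => x i) 2 μ) (i j : Site d) :
    ∫ x, residual ε i x * x j ∂μ
      = ∫ x, x i * x j ∂μ - ε * neighbourAverage (fun k => ∫ x, x k * x j ∂μ) i := by
  have hI : ∀ k, Integrable (fun x : Site d → ℝ => x k * x j) μ := fun k =>
    integrable_fun_mul (hL k) (hL j)
  have e : ∀ x : Site d → ℝ, residual ε i x * x j
      = x i * x j - ε * neighbourAverage (fun k => x k * x j) i := fun x => by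
    rw [← neighbourAverage_mul_const, residual]
    ring
  simp_rw [e]
  rw [integral_sub (hI i) ((integrable_neighbourAverage hI i).const_mul ε), integral_const_mul,
    integral_neighbourAverage hI]

theorem residual_mem_span (i : Site d) : residual ε i ∈
    Submodule.span ℝ (Set.range fun (j : Site d) (x : Site d → ℝ) => x j) :=
  Submodule.sub_mem _ (eval_mem_span i)
    (Submodule.smul_mem _ ε (neighbourAverage_mem (U := fun x => x) eval_mem_span i))

/-- A centered Gaussian field whose covariance is the Green function has the prescribed conditional
laws. -/
theorem conditional_of_covariance_eq_green (hd : 1 ≤ d) (hε : |ε| < 1) {μ : Measure (Site d → ℝ)}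
    (hμ : IsGaussianProcess (fun (i : Site d) (x : Site d → ℝ) => x i) μ)
    (h0 : ∀ i, ∫ x, x i ∂μ = 0) (hcov : ∀ i j, ∫ x, x i * x j ∂μ = green ε i j) (i : Site d) :
    IndepFun (others i) (residual ε i) μ ∧ μ.map (residual ε i) = gaussianReal 0 1 := by
  have := hμ.isProbabilityMeasure
  have hL : ∀ i, MemLp (fun x : Site d → ℝ => x i) 2 μ := fun i =>
    (hμ.hasGaussianLaw_eval i).memLp_two
  -- The resolvent equation of the Green function says exactly that the residual is orthogonal to
  -- all other coordinates; for jointly Gaussian variables this is independence.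
  have hR : ∀ j, ∫ x, residual ε i x * x j ∂μ = if i = j then 1 else 0 := by
    intro j
    rw [integral_residual_mul hL]
    simp_rw [hcov]
    rw [green_eq hd hε i j, add_sub_cancel_right]
  have hproc : IsGaussianProcess (fun (_ : Unit) => residual ε i) μ :=
    isGaussianProcess_of_mem_span hμ fun _ => residual_mem_span i
  have hRL : MemLp (residual ε i) 2 μ := (hproc.hasGaussianLaw_eval ()).memLp_two
  have hR0 : ∫ x, residual ε i x ∂μ = 0 := by
    have hI : ∀ k, Integrable (fun x : Site d → ℝ => x k) μ := fun k =>
      (hμ.hasGaussianLaw_eval k).integrable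
    simp only [residual]
    rw [integral_sub (hI i) ((integrable_neighbourAverage (U := fun x => x) hI i).const_mul ε),
      integral_const_mul, integral_neighbourAverage (U := fun x => x) hI]
    simp [h0, neighbourAverage]
  constructor
  · have hjoint : IsGaussianProcess (Sum.elim
        (fun (j : {j : Site d // j ≠ i}) (x : Site d → ℝ) => x j)
        (fun (_ : Unit) => residual ε i)) μ := by
      refine isGaussianProcess_of_mem_span hμ ?_
      rintro (j | _)
      · exact eval_mem_span (j : Site d)
      · exact residual_mem_span i
    have h := hjoint.indepFun_of_covariance_eq_zero
      (fun j => (measurable_pi_apply _).aemeasurable)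
      (fun _ => (measurable_residual i).aemeasurable) fun j _ => by
        rw [covariance_eq_sub (hL _) hRL, h0, zero_mul, sub_zero]
        have := hR j
        rw [if_neg j.2.symm] at this
        rw [← this]
        exact integral_congr_ae (ae_of_all _ fun x => mul_comm _ _)
    exact h.comp measurable_id (measurable_pi_apply ())
  -- Expand only one factor: the residual has covariance 1 with X_i and 0 with the neighbours.
  · have hvar : ∫ x, residual ε i x * residual ε i x ∂μ = 1 := by
      have hI : ∀ k, Integrable (fun x : Site d → ℝ => x k * residual ε i x) μ := fun k =>
        integrable_fun_mul (hL k) hRL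
      have hR' : ∀ k, ∫ x, x k * residual ε i x ∂μ = if i = k then 1 else 0 := fun k => by
        rw [← hR k]
        exact integral_congr_ae (ae_of_all _ fun x => mul_comm _ _)
      have e : ∀ x : Site d → ℝ, residual ε i x * residual ε i x = x i * residual ε i x
          - ε * neighbourAverage (fun k => x k * residual ε i x) i := fun x => by
        rw [← neighbourAverage_mul_const]
        conv_lhs => enter [1]; rw [residual]
        ring
      simp_rw [e]
      rw [integral_sub (hI i) ((integrable_neighbourAverage hI i).const_mul ε),
        integral_const_mul, integral_neighbourAverage hI]
      simp [hR', neighbourAverage, fun k => (add_single_ne i k).symm,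
        fun k => (sub_single_ne i k).symm]
    have h := map_linearCombination_eq_gaussianReal hproc (fun _ => hR0) {()} 1
    simpa [hvar] using h

/-- The covariance of a field with the prescribed conditional laws is the Green function. -/
theorem covariance_eq_green (hd : 1 ≤ d) (hε : |ε| < 1) {μ : Measure (Site d → ℝ)}
    (hμ : IsGaussianMarkovField d ε μ) (i j : Site d) :
    ∫ x, x i * x j ∂μ = green ε i j := by
  have := hμ.toIsProbabilityMeasure
  have hL : ∀ i, MemLp (fun x : Site d → ℝ => x i) 2 μ := fun i =>
    (hμ.gaussian.hasGaussianLaw_eval i).memLp_two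
  have hres : ∀ i j, ∫ x, residual ε i x * x j ∂μ = if i = j then 1 else 0 := by
    intro i j
    obtain ⟨hind, hlaw⟩ := (conditional_iff μ i).1 (hμ.conditional i)
    have hr := measurable_residual (ε := ε) i
    have hmean : ∫ x, residual ε i x ∂μ = 0 := by
      have h := integral_map (μ := μ) hr.aemeasurable (f := fun x : ℝ => x) (by fun_prop)
      rw [← h, hlaw, integral_id_gaussianReal]
    have hoth : ∀ g : ({j : Site d // j ≠ i} → ℝ) → ℝ, Measurable g →
        ∫ x, residual ε i x * g (others i x) ∂μ = 0 := by
      intro g hg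
      have h : IndepFun (residual ε i) (fun x => g (others i x)) μ :=
        hind.symm.comp measurable_id hg
      rw [h.integral_fun_mul_eq_mul_integral hr.aestronglyMeasurable
        (hg.comp (measurable_others i)).aestronglyMeasurable, hmean, zero_mul]
    split_ifs with hij
    · subst hij
      have hsq : ∫ x, residual ε i x ^ 2 ∂μ = 1 := by
        have h := integral_map (μ := μ) hr.aemeasurable (f := fun x : ℝ => x ^ 2) (by fun_prop)
        rw [← h, hlaw, ← variance_of_integral_eq_zero (X := fun x => x) (by fun_prop)
          (by simp [integral_id_gaussianReal]), variance_fun_id_gaussianReal]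
        simp
      have hRL : MemLp (residual ε i) 2 μ := by
        have hproc : IsGaussianProcess (fun (_ : Unit) => residual ε i) μ :=
          isGaussianProcess_of_mem_span hμ.gaussian fun _ => residual_mem_span i
        exact (hproc.hasGaussianLaw_eval ()).memLp_two
      -- The prediction is X_i minus the residual, and it is orthogonal to the residual; hence the
      -- residual has the same product moment with X_i as with itself, namely 1.
      have hpred := hoth _ (measurable_prediction (ε := ε) i)
      have e : ∀ x : Site d → ℝ, residual ε i x * prediction ε i (others i x)
          = residual ε i x * x i - residual ε i x ^ 2 := fun x => by
        rw [prediction_others, residual]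
        ring
      simp_rw [e] at hpred
      rw [integral_sub (integrable_fun_mul hRL (hL i)) hRL.integrable_sq, hsq] at hpred
      linarith
    · exact hoth (fun y => y ⟨j, fun h => hij h.symm⟩) (measurable_pi_apply _)
  have hK : ∀ i, ∫ x, x i * x j ∂μ = (if i = j then 1 else 0)
      + ε * neighbourAverage (fun k => ∫ x, x k * x j ∂μ) i := by
    intro i
    have := integral_residual_mul (ε := ε) hL i j
    rw [hres] at this
    linarith
  -- Stationarity enters here: it makes the covariance bounded, which selects the Green function
  -- among the solutions of the resolvent equation.
  have hsq : ∀ i, ∫ x, x i ^ 2 ∂μ = ∫ x, x 0 ^ 2 ∂μ := by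
    intro i
    conv_rhs => rw [← hμ.stationary i]
    have hm : Measurable (shift i : (Site d → ℝ) → Site d → ℝ) :=
      measurable_pi_lambda _ fun _ => measurable_pi_apply _
    rw [integral_map hm.aemeasurable ((measurable_pi_apply 0).pow_const 2).aestronglyMeasurable]
    simp [shift]
  have hbound : ∀ i, |∫ x, x i * x j ∂μ| ≤ ∫ x, x 0 ^ 2 ∂μ := by
    intro i
    refine abs_integral_le_integral_abs.trans ?_
    have h : ∫ x, |x i * x j| ∂μ ≤ ∫ x, (x i ^ 2 + x j ^ 2) / 2 ∂μ := by
      refine integral_mono (integrable_fun_mul (hL i) (hL j)).abs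
        (((hL i).integrable_sq.add (hL j).integrable_sq).div_const 2) fun x => ?_
      simp only [abs_mul]
      nlinarith [sq_nonneg (|x i| - |x j|), sq_abs (x i), sq_abs (x j)]
    refine h.trans (le_of_eq ?_)
    rw [integral_div, integral_add (hL i).integrable_sq (hL j).integrable_sq, hsq i, hsq j]
    ring
  exact congrFun (eq_of_resolvent_eq hd hε (b := fun i => if i = j then 1 else 0)
    (C := max (∫ x, x 0 ^ 2 ∂μ) (1 - |ε|)⁻¹)
    (fun i => (hbound i).trans (le_max_left _ _))
    (fun i => (abs_green_le hd hε i j).trans (le_max_right _ _)) hK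
    fun i => green_eq hd hε i j) i

end Markov

end GaussFactor

namespace GaussFactor

open Filter Topology
open scoped NNReal ENNReal

/-! ### Total variation bounds for products and for shifted Gaussians. -/

section TotalVariation

variable {α β : Type*} [MeasurableSpace α] [MeasurableSpace β]

/-- The measures `μ` and `ν` differ by at most `c` on every measurable set. -/
def TVBound (μ ν : Measure α) (c : ℝ) : Prop :=
  ∀ A, MeasurableSet A → |μ.real A - ν.real A| ≤ c

theorem TVBound.tvDist_le {μ ν : Measure α} {c : ℝ} (h : TVBound μ ν c) : tvDist μ ν ≤ c :=
  have : Nonempty {A : Set α // MeasurableSet A} := ⟨∅, .empty⟩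
  ciSup_le fun A => h A.1 A.2

theorem TVBound.map {μ ν : Measure α} {c : ℝ} (h : TVBound μ ν c) {f : α → β} (hf : Measurable f) :
    TVBound (μ.map f) (ν.map f) c := by
  intro A hA
  rw [map_measureReal_apply hf hA, map_measureReal_apply hf hA]
  exact h _ (hf hA)

theorem measureReal_prod_eq_integral (μ : Measure α) (ν : Measure β) [IsProbabilityMeasure μ]
    [IsProbabilityMeasure ν] {A : Set (α × β)} (hA : MeasurableSet A) :
    (μ.prod ν).real A = ∫ x, ν.real (Prod.mk x ⁻¹' A) ∂μ := by
  simp only [Measure.real]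
  rw [Measure.prod_apply hA, integral_toReal (measurable_measure_prodMk_left hA).aemeasurable
    (ae_of_all _ fun x => measure_lt_top _ _)]

theorem integrable_measureReal_section (μ : Measure α) (ν : Measure β) [IsProbabilityMeasure μ]
    [IsProbabilityMeasure ν] {A : Set (α × β)} (hA : MeasurableSet A) :
    Integrable (fun x => ν.real (Prod.mk x ⁻¹' A)) μ :=
  .of_bound (measurable_measure_prodMk_left hA).ennreal_toReal.aestronglyMeasurable 1
    (ae_of_all _ fun x => by
      rw [Real.norm_of_nonneg measureReal_nonneg]
      exact measureReal_le_one)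

theorem TVBound.prod_left (ρ : Measure α) {μ ν : Measure β} [IsProbabilityMeasure ρ]
    [IsProbabilityMeasure μ] [IsProbabilityMeasure ν] {c : ℝ} (h : TVBound μ ν c) :
    TVBound (ρ.prod μ) (ρ.prod ν) c := by
  intro A hA
  rw [measureReal_prod_eq_integral _ _ hA, measureReal_prod_eq_integral _ _ hA,
    ← integral_sub (integrable_measureReal_section ρ μ hA) (integrable_measureReal_section ρ ν hA)]
  have := norm_integral_le_of_norm_le_const (μ := ρ)
    (f := fun x => μ.real (Prod.mk x ⁻¹' A) - ν.real (Prod.mk x ⁻¹' A))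
    (ae_of_all _ fun x => h _ (measurable_prodMk_left (x := x) hA))
  simpa using this

/-- Replace one factor at a time, through the intermediate law `μ.prod ν'`. -/
theorem TVBound.prod {μ ν : Measure α} {μ' ν' : Measure β} [IsProbabilityMeasure μ]
    [IsProbabilityMeasure ν] [IsProbabilityMeasure μ'] [IsProbabilityMeasure ν'] {a b : ℝ}
    (h : TVBound μ ν a) (h' : TVBound μ' ν' b) :
    TVBound (μ.prod μ') (ν.prod ν') (a + b) := by
  have h1 := h'.prod_left μ
  have h2 := (h.prod_left ν').map measurable_swap
  rw [Measure.prod_swap, Measure.prod_swap] at h2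
  intro A hA
  rw [add_comm a b]
  exact (abs_sub_le _ _ _).trans (add_le_add (h1 A hA) (h2 A hA))

theorem TVBound.pi_fin {n : ℕ} {μ ν : Fin n → Measure α} [∀ i, IsProbabilityMeasure (μ i)]
    [∀ i, IsProbabilityMeasure (ν i)] {c : Fin n → ℝ} (h : ∀ i, TVBound (μ i) (ν i) (c i)) :
    TVBound (Measure.pi μ) (Measure.pi ν) (∑ i, c i) := by
  induction n with
  | zero =>
    intro A _
    rw [Measure.pi_of_empty, Measure.pi_of_empty]
    simp
  | succ n ih =>
    have h1 := (measurePreserving_piFinSuccAbove μ 0).symm.map_eq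
    have h2 := (measurePreserving_piFinSuccAbove ν 0).symm.map_eq
    rw [← h1, ← h2, Fin.sum_univ_succ]
    exact ((h 0).prod (ih fun i => h i.succ)).map (MeasurableEquiv.measurable _)

theorem TVBound.pi {ι : Type*} [Fintype ι] {μ ν : ι → Measure α} [∀ i, IsProbabilityMeasure (μ i)]
    [∀ i, IsProbabilityMeasure (ν i)] {c : ι → ℝ} (h : ∀ i, TVBound (μ i) (ν i) (c i)) :
    TVBound (Measure.pi μ) (Measure.pi ν) (∑ i, c i) := by
  let e := (Fintype.equivFin ι).symm
  have h1 := (measurePreserving_piCongrLeft μ e).map_eq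
  have h2 := (measurePreserving_piCongrLeft ν e).map_eq
  rw [← h1, ← h2, ← e.sum_comp]
  exact (TVBound.pi_fin fun i => h (e i)).map (MeasurableEquiv.measurable _)

/-- At variance 1/2 the peak of the density is 1/√π < 1, so the total variation bound for shifts has
constant 1. -/
theorem gaussianPDFReal_le_one {v : ℝ≥0} (hv : (v : ℝ) = 1 / 2) (z x : ℝ) :
    gaussianPDFReal z v x ≤ 1 := by
  rw [gaussianPDFReal, hv]
  refine mul_le_one₀ (inv_le_one_of_one_le₀ (Real.one_le_sqrt.2 ?_)) (Real.exp_pos _).le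
    (Real.exp_le_one_iff.2 ?_)
  · nlinarith [Real.pi_gt_three]
  · rw [neg_div]
    exact neg_nonpos.2 (by positivity)

theorem measureReal_gaussianReal {v : ℝ≥0} (hv : v ≠ 0) (z : ℝ) (A : Set ℝ) :
    (gaussianReal z v).real A = ∫ x in A, gaussianPDFReal z v x := by
  rw [Measure.real, gaussianReal_apply_eq_integral z hv, ENNReal.toReal_ofReal]
  exact integral_nonneg fun x => gaussianPDFReal_nonneg _ _ _

theorem gaussianReal_sub_le {v : ℝ≥0} (hv : (v : ℝ) = 1 / 2) {z w : ℝ} (hzw : z ≤ w) {A : Set ℝ}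
    (hA : MeasurableSet A) :
    (gaussianReal z v).real A - (gaussianReal w v).real A ≤ w - z := by
  have hv0 : v ≠ 0 := by
    rintro rfl
    norm_num at hv
  set m := (z + w) / 2 with hm
  have hI : ∀ z, Integrable (gaussianPDFReal z v) := fun z => integrable_gaussianPDFReal z v
  -- The density centered at z dominates exactly to the left of the midpoint m, so the half-line up
  -- to m is the extremal set.
  have h1 : (gaussianReal z v).real A - (gaussianReal w v).real A
      ≤ (gaussianReal z v).real (Set.Iic m) - (gaussianReal w v).real (Set.Iic m) := by
    simp_rw [measureReal_gaussianReal hv0]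
    rw [← integral_sub (hI z).integrableOn (hI w).integrableOn,
      ← integral_sub (hI z).integrableOn (hI w).integrableOn,
      ← integral_indicator hA, ← integral_indicator measurableSet_Iic]
    refine integral_mono (((hI z).sub (hI w)).indicator hA)
      (((hI z).sub (hI w)).indicator measurableSet_Iic) fun x => ?_
    have hle : ∀ {s t : ℝ}, (x - t) ^ 2 ≤ (x - s) ^ 2 →
        gaussianPDFReal s v x ≤ gaussianPDFReal t v x := by
      intro s t hst
      unfold gaussianPDFReal
      gcongr
    simp only [Set.indicator, Set.mem_Iic]
    by_cases hx : x ≤ m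
    · have := hle (s := w) (t := z) (by nlinarith)
      split_ifs <;> linarith
    · have := hle (s := z) (t := w) (by nlinarith)
      split_ifs <;> linarith
  refine h1.trans ?_
  -- Translating back to mean z leaves the mass of an interval of length w - z under a density at
  -- most 1.
  have h2 : (gaussianReal w v).real (Set.Iic m)
      = (gaussianReal z v).real (Set.Iic (m - (w - z))) := by
    have hg := gaussianReal_map_add_const (μ := z) (v := v) (w - z)
    rw [add_sub_cancel] at hg
    rw [← hg, map_measureReal_apply (by fun_prop) measurableSet_Iic]
    congr 1
    ext x
    simp [le_sub_iff_add_le]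
  rw [h2, ← measureReal_sdiff (Set.Iic_subset_Iic.2 (by linarith)) measurableSet_Iic,
    measureReal_gaussianReal hv0]
  rw [show Set.Iic m \ Set.Iic (m - (w - z)) = Set.Ioc (m - (w - z)) m by
    ext x
    simp [and_comm]]
  have h3 : ∫ x in Set.Ioc (m - (w - z)) m, gaussianPDFReal z v x
      ≤ ∫ x in Set.Ioc (m - (w - z)) m, (1 : ℝ) :=
    integral_mono (hI z).integrableOn (integrable_const _) fun x => gaussianPDFReal_le_one hv z x
  refine h3.trans (le_of_eq ?_)
  rw [setIntegral_const, smul_eq_mul, mul_one, Real.volume_real_Ioc_of_le (by linarith)]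
  ring

theorem tvBound_gaussianReal {v : ℝ≥0} (hv : (v : ℝ) = 1 / 2) (z w : ℝ) :
    TVBound (gaussianReal z v) (gaussianReal w v) |z - w| := by
  have key : ∀ z w : ℝ, z ≤ w → TVBound (gaussianReal z v) (gaussianReal w v) |z - w| := by
    intro z w hzw A hA
    have h1 := gaussianReal_sub_le hv hzw hA
    -- The one-sided bound for the complement is the opposite inequality for A.
    have h2 := gaussianReal_sub_le hv hzw hA.compl
    rw [measureReal_compl hA, measureReal_compl hA] at h2
    simp only [probReal_univ] at h2
    rw [abs_of_nonpos (sub_nonpos.2 hzw), abs_le]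
    constructor <;> linarith
  rcases le_total z w with h | h
  · exact key z w h
  · intro A hA
    rw [abs_sub_comm, abs_sub_comm z]
    exact key w z h A hA

end TotalVariation

/-! ### From L¹ closeness of the means to total variation closeness of the mixtures. -/

section Mixture

variable {d : ℕ} {a : ℕ → ℝ} {ε : ℝ}

theorem map_whiteNoise_prod {T : Type*} :
    (whiteNoise (T × Bool)).map (fun ω => ((fun t => ω (t, false)), fun t => ω (t, true)))
      = (whiteNoise T).prod (whiteNoise T) := by
  have hind : IndepFun (fun (ω : T × Bool → ℝ) t => ω (t, false)) (fun ω t => ω (t, true))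
      (whiteNoise (T × Bool)) := by
    classical
    refine IsGaussianProcess.indepFun_of_covariance_eq_zero ?_
      (fun t => (measurable_pi_apply _).aemeasurable)
      (fun t => (measurable_pi_apply _).aemeasurable) fun s t => ?_
    · refine isGaussianProcess_of_mem_span isGaussianProcess_whiteNoise ?_
      rintro (t | t)
      · exact eval_mem_span (t, false)
      · exact eval_mem_span (t, true)
    · rw [covariance_eq_sub (memLp_whiteNoise _) (memLp_whiteNoise _), integral_whiteNoise,
        zero_mul, sub_zero]
      exact (integral_mul_whiteNoise (s, false) (t, true)).trans (if_neg (by simp))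
  have hm : ∀ b, Measurable fun (ω : T × Bool → ℝ) t => ω (t, b) := fun b =>
    measurable_pi_lambda _ fun t => measurable_pi_apply _
  rw [(indepFun_iff_map_prod_eq_prod_map_map (hm _).aemeasurable (hm _).aemeasurable).1 hind,
    map_whiteNoise_of_injective (Prod.mk_left_injective _),
    map_whiteNoise_of_injective (Prod.mk_left_injective _)]

/-- The field `(Z(ξ) + η / √2)` restricted to `Λ`, as a function of `Z(ξ)` and `η`. -/
noncomputable def noisy (Λ : Finset (Site d)) (z η : Site d → ℝ) (i : Λ) : ℝ :=
  (√2)⁻¹ * η i + z i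

theorem map_noisy_whiteNoise (Λ : Finset (Site d)) (z : Site d → ℝ) {v : ℝ≥0}
    (hv : (v : ℝ) = 1 / 2) :
    (whiteNoise (Site d)).map (noisy Λ z) = Measure.pi fun i : Λ => gaussianReal (z i) v := by
  have h1 : noisy Λ z = (fun (y : Λ → ℝ) i => (√2)⁻¹ * y i + z i) ∘ Λ.restrict := rfl
  have h2 : (gaussianReal 0 1).map (fun x => (√2)⁻¹ * x) = gaussianReal 0 v := by
    rw [gaussianReal_map_const_mul, mul_zero, mul_one]
    congr 1
    ext
    simp [hv]
  have h3 : ∀ i : Λ, (gaussianReal 0 1).map (fun x => (√2)⁻¹ * x + z i) = gaussianReal (z i) v := by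
    intro i
    rw [show (fun x : ℝ => (√2)⁻¹ * x + z i) = (fun x => x + z i) ∘ fun x => (√2)⁻¹ * x from rfl,
      ← Measure.map_map (by fun_prop) (by fun_prop), h2, gaussianReal_map_add_const, zero_add]
  rw [h1, ← Measure.map_map (by fun_prop) (by fun_prop), whiteNoise,
    Measure.infinitePi_map_restrict, ← Measure.infinitePi_eq_pi,
    Measure.infinitePi_map_pi (X := fun _ : Λ => ℝ) (μ := fun _ => gaussianReal 0 1)
      (f := fun i x => (√2)⁻¹ * x + z i) (fun i => by fun_prop)]
  simp_rw [h3]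
  rw [Measure.infinitePi_eq_pi]

theorem measurable_noisy_uncurry (Λ : Finset (Site d)) {Z : (Site d → ℝ) → Site d → ℝ}
    (hZ : Measurable Z) :
    Measurable fun p : (Site d → ℝ) × (Site d → ℝ) => noisy Λ (Z p.1) p.2 := by
  unfold noisy
  fun_prop

/-- The law on `Λ` of a function of `ω (·, false)` plus the independent noise is a mixture. -/
theorem measureReal_map_noisy (Λ : Finset (Site d)) {Z : (Site d → ℝ) → Site d → ℝ}
    (hZ : Measurable Z) {A : Set (Λ → ℝ)} (hA : MeasurableSet A) :
    ((whiteNoise (Site d × Bool)).map fun ω => noisy Λ (Z fun j => ω (j, false))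
      fun j => ω (j, true)).real A = ∫ ξ, (whiteNoise (Site d)).real (noisy Λ (Z ξ) ⁻¹' A)
        ∂(whiteNoise (Site d)) := by
  have hm := measurable_noisy_uncurry Λ hZ
  have hpair : Measurable fun ω : Site d × Bool → ℝ =>
      ((fun t => ω (t, false)), fun t => ω (t, true)) := by fun_prop
  have := Measure.map_map (μ := whiteNoise (Site d × Bool)) hm hpair
  rw [map_whiteNoise_prod] at this
  rw [show (fun ω : Site d × Bool → ℝ => noisy Λ (Z fun j => ω (j, false)) fun j => ω (j, true))
    = (fun p : (Site d → ℝ) × (Site d → ℝ) => noisy Λ (Z p.1) p.2) ∘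
      fun ω => ((fun t => ω (t, false)), fun t => ω (t, true)) from rfl, ← this,
    map_measureReal_apply hm hA, measureReal_prod_eq_integral _ _ (hm hA)]
  rfl

theorem tvBound_map_noisy (Λ : Finset (Site d)) {Z W : (Site d → ℝ) → Site d → ℝ}
    (hZ : Measurable Z) (hW : Measurable W) {c : ℝ} (hc : 0 ≤ c)
    (h : ∀ i, ∫⁻ ξ, ‖Z ξ i - W ξ i‖ₑ ∂(whiteNoise (Site d)) ≤ ENNReal.ofReal c) :
    TVBound
      ((whiteNoise (Site d × Bool)).map fun ω => noisy Λ (Z fun j => ω (j, false))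
        fun j => ω (j, true))
      ((whiteNoise (Site d × Bool)).map fun ω => noisy Λ (W fun j => ω (j, false))
        fun j => ω (j, true)) (Λ.card * c) := by
  intro A hA
  have hv : ((1 / 2 : ℝ≥0) : ℝ) = 1 / 2 := by norm_num
  have hI : ∀ {V : (Site d → ℝ) → Site d → ℝ}, Measurable V → Integrable
      (fun ξ => (whiteNoise (Site d)).real (noisy Λ (V ξ) ⁻¹' A)) (whiteNoise (Site d)) :=
    fun hV => integrable_measureReal_section _ _ (measurable_noisy_uncurry Λ hV hA)
  rw [measureReal_map_noisy Λ hZ hA, measureReal_map_noisy Λ hW hA, ← integral_sub (hI hZ) (hI hW)]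
  -- For fixed ξ both laws are products of Gaussians of variance 1/2, so the bounds for the single
  -- sites add up.
  have hpt : ∀ ξ, ‖(whiteNoise (Site d)).real (noisy Λ (Z ξ) ⁻¹' A)
      - (whiteNoise (Site d)).real (noisy Λ (W ξ) ⁻¹' A)‖ₑ ≤ ∑ i : Λ, ‖Z ξ i - W ξ i‖ₑ := by
    intro ξ
    have hn : ∀ z, Measurable (noisy Λ z) := fun z =>
      (measurable_noisy_uncurry Λ measurable_id).comp measurable_prodMk_left
    rw [← map_measureReal_apply (hn _) hA, ← map_measureReal_apply (hn _) hA,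
      map_noisy_whiteNoise Λ _ hv, map_noisy_whiteNoise Λ _ hv]
    have := TVBound.pi (fun i : Λ => tvBound_gaussianReal hv (Z ξ i) (W ξ i)) A hA
    simp_rw [Real.enorm_eq_ofReal_abs]
    rw [← ENNReal.ofReal_sum_of_nonneg fun i _ => abs_nonneg _]
    exact ENNReal.ofReal_le_ofReal this
  have hle := (enorm_integral_le_lintegral_enorm _).trans
    (lintegral_mono (μ := whiteNoise (Site d)) hpt)
  rw [lintegral_finsetSum _ fun i _ => by fun_prop] at hle
  have hsum : ∑ i : Λ, ∫⁻ ξ, ‖Z ξ i - W ξ i‖ₑ ∂(whiteNoise (Site d))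
      ≤ ENNReal.ofReal (Λ.card * c) := by
    refine (Finset.sum_le_card_nsmul _ _ _ fun i _ => h i.1).trans (le_of_eq ?_)
    rw [ENNReal.ofReal_mul (by positivity)]
    simp
  have := hle.trans hsum
  rw [Real.enorm_eq_ofReal_abs, ENNReal.ofReal_le_ofReal_iff (by positivity)] at this
  exact this

end Mixture

end GaussFactor

namespace GaussFactor

open Filter Topology

/-! ### Assembly: stationarity, factor map, uniqueness and finite-range approximation. -/

section Main

variable {d : ℕ} {a : ℕ → ℝ} {ε : ℝ}

theorem isGaussianProcess_map {T Ω : Type*} {mΩ : MeasurableSpace Ω} {P : Measure Ω}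
    {F : Ω → T → ℝ} (hF : Measurable F) (h : IsGaussianProcess (fun t ω => F ω t) P) :
    IsGaussianProcess (fun (t : T) (x : T → ℝ) => x t) (P.map F) := by
  refine ⟨fun I => ⟨?_⟩⟩
  have := (h.hasGaussianLaw I).isGaussian_map
  rwa [Measure.map_map (by fun_prop) hF]

theorem integral_map_eval {T Ω : Type*} {mΩ : MeasurableSpace Ω} {P : Measure Ω}
    {F : Ω → T → ℝ} (hF : Measurable F) (t : T) :
    ∫ x, x t ∂(P.map F) = ∫ ω, F ω t ∂P :=
  integral_map hF.aemeasurable (measurable_pi_apply t).aestronglyMeasurable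

theorem integral_map_eval_mul_eval {T Ω : Type*} {mΩ : MeasurableSpace Ω} {P : Measure Ω}
    {F : Ω → T → ℝ} (hF : Measurable F) (s t : T) :
    ∫ x, x s * x t ∂(P.map F) = ∫ ω, F ω s * F ω t ∂P :=
  integral_map hF.aemeasurable
    ((measurable_pi_apply s).mul (measurable_pi_apply t)).aestronglyMeasurable

theorem limitField_shift (v : Site d) (ω : Site d × Bool → ℝ) :
    limitField a ε (fun p => ω (p.1 + v, p.2)) = shift v (limitField a ε ω) := by
  ext i
  exact congrArg ((√2)⁻¹ * ω (i + v, true) + ·)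
    (congrFun (fullAverage_shift (a := a) (ε := ε) v fun j => ω (j, false)) i)

theorem isStationary_map_limitField :
    IsStationary ((whiteNoise (Site d × Bool)).map (limitField a ε)) := by
  intro v
  have hinj : Function.Injective fun p : Site d × Bool => (p.1 + v, p.2) := by
    rintro ⟨i, b⟩ ⟨j, c⟩ h
    simpa using h
  have hm : Measurable (shift v : (Site d → ℝ) → Site d → ℝ) :=
    measurable_pi_lambda _ fun _ => measurable_pi_apply _
  have hm' : Measurable fun (ω : Site d × Bool → ℝ) (p : Site d × Bool) => ω (p.1 + v, p.2) :=
    measurable_pi_lambda _ fun _ => measurable_pi_apply _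
  rw [Measure.map_map hm measurable_limitField]
  conv_rhs => rw [← map_whiteNoise_of_injective hinj, Measure.map_map measurable_limitField hm']
  congr 1
  ext ω : 1
  exact (limitField_shift v ω).symm

theorem isFactorOfIID_map_limitField :
    IsFactorOfIID ((whiteNoise (Site d × Bool)).map (limitField a ε)) := by
  have hm : Measurable fun (y : Site d → Bool → ℝ) (p : Site d × Bool) => y p.1 p.2 := by fun_prop
  -- Each site carries two independent standard normals, one for each of the two noises.
  refine ⟨Bool → ℝ, inferInstance, Measure.infinitePi fun _ => gaussianReal 0 1, inferInstance,
    fun y => limitField a ε fun p => y p.1 p.2, measurable_limitField.comp hm, fun v y => ?_, ?_⟩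
  · exact limitField_shift v fun p => y p.1 p.2
  · have h := Measure.infinitePi_map_curry_symm (ι := Site d) (κ := Bool)
      fun _ _ => gaussianReal 0 1
    rw [whiteNoise, ← h, Measure.map_map measurable_limitField (MeasurableEquiv.measurable _)]
    rfl

theorem isGaussianMarkovField_map_limitField (hd : 1 ≤ d) (ha : ∀ n, |a n| ≤ 2 ^ n)
    (hconv : ∀ n, ∑ p ∈ Finset.HasAntidiagonal.antidiagonal n, a p.1 * a p.2 =
      if n = 0 then 1 / 2 else 1) (hε : |ε| ≤ 1 / 8) :
    IsGaussianMarkovField d ε ((whiteNoise (Site d × Bool)).map (limitField a ε)) := by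
  obtain ⟨h1, h2, h3⟩ := isGaussianProcess_limitField (d := d) hd ha hconv hε
  have hm : Measurable (limitField (d := d) a ε) := measurable_limitField
  have hprob := Measure.isProbabilityMeasure_map (μ := whiteNoise (Site d × Bool)) hm.aemeasurable
  have hg := isGaussianProcess_map hm h1
  have h0 := fun i => (integral_map_eval (P := whiteNoise (Site d × Bool)) hm i).trans (h2 i)
  have hcov := fun i j =>
    (integral_map_eval_mul_eval (P := whiteNoise (Site d × Bool)) hm i j).trans (h3 i j)
  exact
    { toIsProbabilityMeasure := hprob
      gaussian := hg
      centered := h0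
      stationary := isStationary_map_limitField
      conditional := fun i => (conditional_iff _ i).2
        (conditional_of_covariance_eq_green hd (by linarith) hg h0 hcov i) }

theorem IsGaussianMarkovField.unique (hd : 1 ≤ d) (hε : |ε| < 1) {μ μ' : Measure (Site d → ℝ)}
    (h : IsGaussianMarkovField d ε μ) (h' : IsGaussianMarkovField d ε μ') : μ = μ' :=
  eq_of_forall_integral_mul_eq h.gaussian h'.gaussian h.centered h'.centered fun i j => by
    rw [covariance_eq_green hd hε h, covariance_eq_green hd hε h']

/-- With l/2 + 1 terms the exponents are at most l/2, so two of them add up to at most l and every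
kernel in the covariance vanishes beyond distance l. Jointly Gaussian families with zero
cross-covariance are independent. -/
theorem isDependent_map_truncField (a : ℕ → ℝ) (ε : ℝ) (l : ℕ) :
    IsDependent l ((whiteNoise (Site d × Bool)).map (truncField a ε (l / 2 + 1))) := by
  intro A B hAB
  have hm : Measurable (truncField (d := d) a ε (l / 2 + 1)) := measurable_truncField _
  have hprob := Measure.isProbabilityMeasure_map (μ := whiteNoise (Site d × Bool)) hm.aemeasurable
  have hg := isGaussianProcess_map hm (isGaussianProcess_truncField (l / 2 + 1))
  have hL := fun i => (hg.hasGaussianLaw_eval i).memLp_two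
  refine IsGaussianProcess.indepFun_of_covariance_eq_zero ?_
    (fun a => (measurable_pi_apply _).aemeasurable)
    (fun b => (measurable_pi_apply _).aemeasurable) fun i j => ?_
  · refine isGaussianProcess_of_mem_span hg ?_
    rintro (i | j)
    · exact eval_mem_span (i : Site d)
    · exact eval_mem_span (j : Site d)
  · have hij := hAB i i.2 j j.2
    rw [covariance_eq_sub (hL _) (hL _), integral_map_eval hm, integral_truncField, zero_mul,
      sub_zero]
    refine (integral_map_eval_mul_eval hm _ _).trans ?_
    rw [integral_truncField_mul_truncField, walkKernel_eq_zero (by omega), mul_zero, zero_add]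
    refine Finset.sum_eq_zero fun p hp => ?_
    simp only [Finset.mem_product, Finset.mem_range] at hp
    rw [walkKernel_eq_zero (by omega), mul_zero]

theorem tvDist_limitField_truncField_le (hd : 1 ≤ d) (ha : ∀ n, |a n| ≤ 2 ^ n) (hε : |ε| ≤ 1 / 8)
    (N : ℕ) (Λ : Finset (Site d)) :
    tvDist (((whiteNoise (Site d × Bool)).map (limitField a ε)).map Λ.restrict)
        (((whiteNoise (Site d × Bool)).map (truncField a ε N)).map Λ.restrict)
      ≤ Λ.card * (4 / 3 * (1 / 4) ^ N) := by
  rw [Measure.map_map (by fun_prop) measurable_limitField,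
    Measure.map_map (by fun_prop) (measurable_truncField N)]
  exact (tvBound_map_noisy Λ measurable_fullAverage (measurable_partialAverage N) (by positivity)
    (lintegral_fullAverage_sub_partialAverage_le hd ha hε N)).tvDist_le

theorem truncation_error_le (l : ℕ) :
    (4 / 3 * (1 / 4) ^ (l / 2 + 1) : ℝ) ≤ Real.exp (-Real.log 2 * l) := by
  have h1 : Real.exp (-Real.log 2 * l) = (1 / 2) ^ l := by
    rw [← Real.log_inv, mul_comm, Real.exp_nat_mul, Real.exp_log (by norm_num), one_div]
  -- Even with integer division 2(l/2 + 1) ≥ l + 1; the extra factor 1/2 absorbs the constant 4/3.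
  have h2 : ((1 / 4) ^ (l / 2 + 1) : ℝ) ≤ (1 / 2) ^ (l + 1) := by
    rw [show (1 / 4 : ℝ) = (1 / 2) ^ 2 by norm_num, ← pow_mul]
    exact pow_le_pow_of_le_one (by norm_num) (by norm_num) (by omega)
  have h3 : (0 : ℝ) < (1 / 2) ^ l := by positivity
  rw [h1]
  rw [pow_succ (1 / 2 : ℝ) l] at h2
  linarith

end Main

end GaussFactor

theorem theorem1 (d : ℕ) (hd : 1 ≤ d) :
    ∃ ε₀ : ℝ, 0 < ε₀ ∧ ∀ ε : ℝ, |ε| < ε₀ →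
      (∃! μ : Measure (GaussFactor.Site d → ℝ), GaussFactor.IsGaussianMarkovField d ε μ) ∧
      ∀ μ : Measure (GaussFactor.Site d → ℝ), GaussFactor.IsGaussianMarkovField d ε μ →
        GaussFactor.IsFactorOfIID μ ∧
        ∃ c : ℝ, 0 < c ∧ ∀ l : ℕ, ∃ ν : Measure (GaussFactor.Site d → ℝ),
          IsProbabilityMeasure ν ∧ GaussFactor.IsDependent l ν ∧
          ∀ Λ : Finset (GaussFactor.Site d),
            GaussFactor.tvDist (μ.map Λ.restrict) (ν.map Λ.restrict)
              ≤ (Λ.card : ℝ) * Real.exp (-c * l) := by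
  obtain ⟨a, ha, hconv⟩ := GaussFactor.exists_sqrt_coefficients
  -- With |a n| ≤ 2^n, the choice 1/8 makes the nth coefficient at most 4^(-n), whence the rate c =
  -- log 2 after truncation near l/2.
  refine ⟨1 / 8, by norm_num, fun ε hε => ?_⟩
  have hex := GaussFactor.isGaussianMarkovField_map_limitField hd ha hconv hε.le
  have huniq : ∀ μ, GaussFactor.IsGaussianMarkovField d ε μ →
      μ = (GaussFactor.whiteNoise (GaussFactor.Site d × Bool)).map (GaussFactor.limitField a ε) :=
    fun μ hμ => hμ.unique hd (by linarith) hex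
  refine ⟨⟨_, hex, huniq⟩, fun μ hμ => ?_⟩
  rw [huniq μ hμ]
  refine ⟨GaussFactor.isFactorOfIID_map_limitField, Real.log 2, Real.log_pos (by norm_num),
    fun l => ⟨_, ?_, GaussFactor.isDependent_map_truncField a ε l, fun Λ => ?_⟩⟩
  · exact Measure.isProbabilityMeasure_map (GaussFactor.measurable_truncField _).aemeasurable
  · refine (GaussFactor.tvDist_limitField_truncField_le hd ha hε.le _ Λ).trans ?_
    gcongr
    exact GaussFactor.truncation_error_le l
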